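/- Let $p$ be a prime, let $\mathbb C_p$ be the completion of an algebraic closure of $\mathbb Q_p$, with the $p$-adic absolute value $|\cdot|$ normalized by $|p|=1/p$, ring of integers $O_p$, maximal ideal $\mathfrak c_p$ and residue field $k=O_p/\mathfrak c_p\cong\overline{\mathbb F}_p$. For points $x=[X],\,y=[Y]$ of $\mathbb P^N(\mathbb C_p)$ with homogeneous coordinates chosen so that $\max_i|X_i|=\max_i|Y_i|=1$, put $$\Delta(x,y)=\max_{i,j}|X_iY_j-X_jY_i| .$$ Let $C\subseteq\mathbb P^N(\mathbb C_p)$ be an irreducible projective curve with ideal of relations $I\subseteq\mathbb C_p[T_0,\dots,T_N]$. Let $J=I\cap O_p[T_0,\dots,T_N]$, let $\overline J\subseteq k[T_0,\dots,T_N]$ be its reduction modulo $\mathfrak c_p$, and let $\overline C\subseteq\mathbb P^N(k)$ be the zero set of $\overline J$. Assume that $C$ is smooth with good reduction: in affine coordinates $U_j=T_j/T_i$ ($j\ne i$) around the point in question, the Jacobian matrix $(\partial g/\partial U_j)$, with $g$ ranging over the dehomogenizations of the elements of $I$, has rank $N-1$ at every point of $C$, and likewise the Jacobian matrix of $\overline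 J$ has rank $N-1$ at every point of $\overline C$. Let $\phi:C\to C$ be a morphism of good reduction: for every $\bar x=[\bar X]\in\overline C$ there are forms $G_0,\dots,G_N\in O_p[T_0,\dots,T_N]$ of the same degree that represent $\phi$ (that is, $\phi([X])=[G_0(X),\dots,G_N(X)]$ for all $[X]\in C$ at which the $G_i$ do not all vanish) and whose reductions modulo $\mathfrak c_p$ do not all vanish at $\bar X$. Let $K$ be the field of rational functions on $C$ and assume that $\phi$ has degree $d=[K:\phi^*K]>1$. Then for every point $x\in C$ there is a constant $\kappa_x>0$ such that $$\Delta(x,y)\ \ge\ (\kappa_x|n|)^{1/n}$$ for every $n\ge1$ and every $\phi$-periodic point $y\in C$ of least period $n$ with $y\ne x$. -/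

import Mathlib

open MvPolynomial

/-- A tuple of forms, that is, of homogeneous polynomials, of one common degree in `T_0, …, T_N`. -/
def AreForms {R : Type*} [CommRing R] {N : ℕ}
    (G : Fin (N + 1) → MvPolynomial (Fin (N + 1)) R) : Prop :=
  ∃ e : ℕ, ∀ i, (G i).IsHomogeneous e

section Field

variable {K : Type*} [Field K] {N : ℕ}

/-- The ideal of relations of a set of points of projective `N`-space: all polynomials vanishing
at all homogeneous coordinate vectors of its points (over an infinite field this is the
ideal generated by the forms that vanish on the set). -/
def projIdeal (C : Set (Projectivization K (Fin (N + 1) → K))) :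
    Ideal (MvPolynomial (Fin (N + 1)) K) where
  carrier := {f | ∀ (X : Fin (N + 1) → K) (hX : X ≠ 0),
    Projectivization.mk K X hX ∈ C → eval X f = 0}
  zero_mem' := by intro X _ _; simp
  add_mem' := by
    intro f g hf hg X hX hC
    simp [hf X hX hC, hg X hX hC]
  smul_mem' := by
    intro c f hf X hX hC
    simp [hf X hX hC]

/-- The points of projective `N`-space at which all elements of a (homogeneous) ideal vanish. -/
def projZeros (I : Ideal (MvPolynomial (Fin (N + 1)) K)) :
    Set (Projectivization K (Fin (N + 1) → K)) :=
  {x | ∀ (X : Fin (N + 1) → K) (hX : X ≠ 0), Projectivization.mk K X hX = x →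
    ∀ f ∈ I, eval X f = 0}

/-- In the affine chart `T_i = 1` with affine coordinates `U_j`, `j ≠ i`: the row
`(∂g/∂U_j)_j` of the Jacobian matrix at the point with homogeneous coordinates `X`, `X i ≠ 0`,
where `g` is the dehomogenization of `f`. -/
noncomputable def jacobianRow (i : Fin (N + 1)) (X : Fin (N + 1) → K)
    (f : MvPolynomial (Fin (N + 1)) K) : {j : Fin (N + 1) // j ≠ i} → K :=
  fun j => eval (fun k => X k / X i) (pderiv j.1 f)

/-- The Jacobian condition `rank = N - 1` at the point `[X]` for the subscheme of projective
`N`-space defined by `I`, in the affine charts that contain the point. -/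
def IsNonsingularAt (I : Ideal (MvPolynomial (Fin (N + 1)) K)) (X : Fin (N + 1) → K) : Prop :=
  ∀ i, X i ≠ 0 →
    Module.finrank K (Submodule.span K (jacobianRow i X '' (I : Set _))) + 1 = N

/-- An irreducible projective curve in projective `N`-space, as a set of points: a Zariski closed
set whose ideal of relations is prime, of dimension one (so that the homogeneous coordinate ring
has dimension two). -/
structure ProjCurve (K : Type*) [Field K] (N : ℕ) where
  carrier : Set (Projectivization K (Fin (N + 1) → K))
  isClosed : projZeros (projIdeal carrier) = carrier
  isPrime : (projIdeal carrier).IsPrime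
  dim_eq : ringKrullDim (MvPolynomial (Fin (N + 1)) K ⧸ projIdeal carrier) = 2

namespace ProjCurve

/-- The ideal of relations `I(C)`. -/
def ideal (C : ProjCurve K N) : Ideal (MvPolynomial (Fin (N + 1)) K) := projIdeal C.carrier

instance (C : ProjCurve K N) : C.ideal.IsPrime := C.isPrime

theorem one_notMem (C : ProjCurve K N) : (1 : MvPolynomial (Fin (N + 1)) K) ∉ C.ideal :=
  (Ideal.ne_top_iff_one C.ideal).1 C.isPrime.ne_top

/-- The curve is nonsingular at each of its points. -/
def IsSmooth (C : ProjCurve K N) : Prop :=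
  ∀ (X : Fin (N + 1) → K) (hX : X ≠ 0), Projectivization.mk K X hX ∈ C.carrier →
    IsNonsingularAt C.ideal X

/-- The forms `G` represent the map `φ : C → C`: they do not all vanish on `C`, and
`φ([X]) = [G(X)]` for all `[X]` in `C` with `G(X) ≠ 0`. -/
structure Represents (C : ProjCurve K N) (φ : C.carrier → C.carrier)
    (G : Fin (N + 1) → MvPolynomial (Fin (N + 1)) K) : Prop where
  areForms : AreForms G
  nonzero : ∃ j, G j ∉ C.ideal
  apply_eq : ∀ (X : Fin (N + 1) → K) (hX : X ≠ 0)
    (hC : Projectivization.mk K X hX ∈ C.carrier) (hG : (fun i => eval X (G i)) ≠ 0),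
    (φ ⟨Projectivization.mk K X hX, hC⟩ : Projectivization K (Fin (N + 1) → K)) =
      Projectivization.mk K (fun i => eval X (G i)) hG

/-- `φ : C → C` is a morphism: at each point of `C` it has a representation by forms that do not
all vanish at the point. -/
def IsMorphism (C : ProjCurve K N) (φ : C.carrier → C.carrier) : Prop :=
  ∀ (X : Fin (N + 1) → K) (hX : X ≠ 0), Projectivization.mk K X hX ∈ C.carrier →
    ∃ G, C.Represents φ G ∧ (fun i => eval X (G i)) ≠ 0

/-- The class of a polynomial in the fraction field of the homogeneous coordinate ring. -/
noncomputable def toFrac (C : ProjCurve K N) :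
    MvPolynomial (Fin (N + 1)) K →+* FractionRing (MvPolynomial (Fin (N + 1)) K ⧸ C.ideal) :=
  (algebraMap _ _).comp (Ideal.Quotient.mk C.ideal)

theorem toFrac_eq_zero (C : ProjCurve K N) (f : MvPolynomial (Fin (N + 1)) K) :
    C.toFrac f = 0 ↔ f ∈ C.ideal := by
  rw [toFrac, RingHom.comp_apply,
    (injective_iff_map_eq_zero' _).1 (IsFractionRing.injective
      (MvPolynomial (Fin (N + 1)) K ⧸ C.ideal) _), Ideal.Quotient.eq_zero_iff_mem]

/-- For a ring endomorphism `θ` of the polynomial ring, the field of all `θ(F)/θ(G)` with `F`, `G`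
forms of the same degree and `θ(G) ∉ I(C)`. -/
noncomputable def fracField (C : ProjCurve K N)
    (θ : MvPolynomial (Fin (N + 1)) K →ₐ[K] MvPolynomial (Fin (N + 1)) K) :
    Subfield (FractionRing (MvPolynomial (Fin (N + 1)) K ⧸ C.ideal)) where
  carrier := {z | ∃ (e : ℕ) (F G : MvPolynomial (Fin (N + 1)) K), F.IsHomogeneous e ∧
    G.IsHomogeneous e ∧ θ G ∉ C.ideal ∧ z = C.toFrac (θ F) / C.toFrac (θ G)}
  zero_mem' := ⟨0, 0, 1, isHomogeneous_zero _ _ _, isHomogeneous_one _ _,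
    by simpa using C.one_notMem, by simp⟩
  one_mem' := ⟨0, 1, 1, isHomogeneous_one _ _, isHomogeneous_one _ _,
    by simpa using C.one_notMem, by simp⟩
  add_mem' := by
    rintro _ _ ⟨e, F, G, hF, hG, hGI, rfl⟩ ⟨e', F', G', hF', hG', hGI', rfl⟩
    refine ⟨e + e', F * G' + G * F', G * G', (hF.mul hG').add (hG.mul hF'), hG.mul hG', ?_, ?_⟩
    · rw [map_mul]
      exact fun h => (C.isPrime.mem_or_mem h).elim hGI hGI'
    · rw [map_mul, map_add, map_mul, map_mul, map_mul, map_add, map_mul, map_mul]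
      exact div_add_div _ _ (mt (C.toFrac_eq_zero _).1 hGI) (mt (C.toFrac_eq_zero _).1 hGI')
  neg_mem' := by
    rintro _ ⟨e, F, G, hF, hG, hGI, rfl⟩
    exact ⟨e, -F, G, hF.neg, hG, hGI, by simp [neg_div]⟩
  mul_mem' := by
    rintro _ _ ⟨e, F, G, hF, hG, hGI, rfl⟩ ⟨e', F', G', hF', hG', hGI', rfl⟩
    refine ⟨e + e', F * F', G * G', hF.mul hF', hG.mul hG', ?_, ?_⟩
    · rw [map_mul]
      exact fun h => (C.isPrime.mem_or_mem h).elim hGI hGI'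
    · rw [map_mul, map_mul, map_mul, map_mul, div_mul_div_comm]
  inv_mem' := by
    rintro _ ⟨e, F, G, hF, hG, hGI, rfl⟩
    by_cases h : θ F ∈ C.ideal
    · refine ⟨0, 0, 1, isHomogeneous_zero _ _ _, isHomogeneous_one _ _,
        by simpa using C.one_notMem, ?_⟩
      simp [(C.toFrac_eq_zero _).2 h]
    · exact ⟨e, G, F, hG, hF, h, inv_div _ _⟩

/-- The field of rational functions on `C`: all `F/G` with `F`, `G` forms of the same degree and
`G ∉ I(C)`. -/
noncomputable def functionField (C : ProjCurve K N) :
    Subfield (FractionRing (MvPolynomial (Fin (N + 1)) K ⧸ C.ideal)) :=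
  C.fracField (AlgHom.id K _)

/-- The image of the field of rational functions under the pull-back `F/G ↦ F(Φ)/G(Φ)` along the
map that is represented by the forms `Φ`. -/
noncomputable def pullbackField (C : ProjCurve K N)
    (Φ : Fin (N + 1) → MvPolynomial (Fin (N + 1)) K) :
    Subfield (FractionRing (MvPolynomial (Fin (N + 1)) K ⧸ C.ideal)) :=
  C.fracField (bind₁ Φ)

/-- The morphism `φ` has degree `d`, the degree of the field of rational functions over
its image under pull-back along `φ` (which does not depend on the representing forms). For
a constant `φ` that image is the field of constants, and `Subfield.relfinrank` is `0`. -/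
def HasDegree (C : ProjCurve K N) (φ : C.carrier → C.carrier) (d : ℕ) : Prop :=
  ∃ Φ, C.Represents φ Φ ∧ Subfield.relfinrank (C.pullbackField Φ) C.functionField = d

end ProjCurve

end Field

section Padic

variable {p : ℕ} [Fact p.Prime] {N : ℕ}

/-- The residue field of the ring of integers of `ℂ_[p]`. -/
abbrev PadicComplexResidue (p : ℕ) [Fact p.Prime] : Type :=
  IsLocalRing.ResidueField (PadicComplexInt p)

/-- The chordal metric: `Δ([X], [Y]) = max_{i,j} |X_i Y_j - X_j Y_i|` for coordinate
vectors with `|X| = |Y| = 1`; a general vector is normalized through division by `|X| = max |X_i|`.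
(The norm of a finite family is the maximum of the norms.) -/
noncomputable def chordalDist (x y : Projectivization ℂ_[p] (Fin (N + 1) → ℂ_[p])) : ℝ :=
  ‖fun ij : Fin (N + 1) × Fin (N + 1) =>
    x.rep ij.1 * y.rep ij.2 - x.rep ij.2 * y.rep ij.1‖ / (‖x.rep‖ * ‖y.rep‖)

namespace ProjCurve

/-- `J = I(C) ∩ O_p[T_0, …, T_N]`. -/
noncomputable def integralIdeal (C : ProjCurve ℂ_[p] N) :
    Ideal (MvPolynomial (Fin (N + 1)) (PadicComplexInt p)) :=
  C.ideal.comap (MvPolynomial.map (algebraMap (PadicComplexInt p) ℂ_[p]))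

/-- `J` modulo the maximal ideal of `O_p`. -/
noncomputable def reducedIdeal (C : ProjCurve ℂ_[p] N) :
    Ideal (MvPolynomial (Fin (N + 1)) (PadicComplexResidue p)) :=
  C.integralIdeal.map (MvPolynomial.map (IsLocalRing.residue (PadicComplexInt p)))

/-- `C` has good reduction: the Jacobian condition holds at all points of the reduced curve. -/
def HasGoodReduction (C : ProjCurve ℂ_[p] N) : Prop :=
  ∀ (X : Fin (N + 1) → PadicComplexResidue p) (hX : X ≠ 0),
    Projectivization.mk _ X hX ∈ projZeros C.reducedIdeal → IsNonsingularAt C.reducedIdeal X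

/-- `φ` has good reduction: at each point of the reduced curve it has a representation
by forms with coefficients in `O_p` whose reductions do not all vanish at the point. -/
def MapHasGoodReduction (C : ProjCurve ℂ_[p] N) (φ : C.carrier → C.carrier) : Prop :=
  ∀ (X : Fin (N + 1) → PadicComplexResidue p) (hX : X ≠ 0),
    Projectivization.mk _ X hX ∈ projZeros C.reducedIdeal →
    ∃ G : Fin (N + 1) → MvPolynomial (Fin (N + 1)) (PadicComplexInt p),
      C.Represents φ (fun i => MvPolynomial.map (algebraMap (PadicComplexInt p) ℂ_[p]) (G i)) ∧
      (fun i => eval X (MvPolynomial.map (IsLocalRing.residue (PadicComplexInt p)) (G i))) ≠ 0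

end ProjCurve

end Padic

/-! The residue class of `x`, the points of `C` with the same reduction, behaves like an open unit
disc. Since the reduced Jacobian matrix has rank `N - 1`, Nakayama's lemma makes one affine
coordinate `t` a parameter (`exists_parameter`): differences of function values are divisible by
differences of `t`. Only periodic points in this class matter, since all others have chordal
distance at least 1 from `x`.

If the class contains a periodic point `y₀` of period `M`, then `φ^M` induces a self-map `F` of the
class fixing `y₀`. Let `Λ_n` be defined by `t ∘ F^n - t(y₀) = (t - t(y₀)) Λ_n`. After passing to an
iterate, `Λ_1 ≡ 1` modulo the maximal ideal, unless `y₀` is the only periodic point of the class.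
The quotient `Q = (Λ_{ql} - 1)/(Λ_q - 1)` vanishes along every orbit of exact period `ql`, yet `Q ≡
l`. So periods `k > 1` are powers of `p`. For `l = p` and `q` a large power of `p`, `|Q(y₀)| = |p|`,
while `Q` is divisible by the product of `t - t(F^i y)` over the orbit. Hence `|p| ≤ |t(y) -
t(y₀)|^k` (`exists_forall_norm_le_pow_minimalPeriod`). For large `k` such `y` is farther from `y₀`
than `x` is, so the estimate passes to `|t(y) - t(x)|`.

The remaining periods are bounded, so these points are fixed by one common iterate of `φ`. As the
degree exceeds 1, this iterate is not the identity, and smoothness keeps its fixed points from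
accumulating at `x` (`exists_forall_le_norm_of_iterate_eq`). Altogether `κ ≤ Δ(x,y)^n`, which is
stronger than the claim because `|n| ≤ 1`. -/

/-! ### Dynamics of self-maps of an ultrametric disc near a fixed point. -/

section Dynamics

set_option linter.unusedSectionVars false

variable {O : Type*} [NormedCommRing O] [NormMulClass O] [NormOneClass O] [IsUltrametricDist O]
  {Z : Type*}

theorem norm_sub_lt_trans {a b c : O} {r : ℝ} (hab : ‖a - b‖ < r) (hbc : ‖b - c‖ < r) :
    ‖a - c‖ < r := by
  rw [← sub_add_sub_cancel a b c]
  exact (IsUltrametricDist.norm_add_le_max _ _).trans_lt (max_lt hab hbc)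

theorem norm_eq_one_of_sub_one_lt {a : O} (ha : ‖a - 1‖ < 1) : ‖a‖ = 1 := by
  have h := IsUltrametricDist.norm_add_eq_max_of_norm_ne_norm (x := a - 1) (y := 1)
    (by rw [norm_one]; exact ha.ne)
  rw [sub_add_cancel, norm_one, max_eq_right ha.le] at h
  exact h

theorem norm_mul_sub_one_lt {a b : O} {r : ℝ} (ha : ‖a - 1‖ < r) (hb : ‖b - 1‖ < r)
    (ha1 : ‖a‖ ≤ 1) : ‖a * b - 1‖ < r := by
  refine norm_sub_lt_trans (b := a) ?_ ha
  rw [← mul_sub_one, norm_mul]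
  exact (mul_le_of_le_one_left (norm_nonneg _) ha1).trans_lt hb

theorem norm_pow_sub_one_lt {a : O} {r : ℝ} (hr : 0 < r) (ha : ‖a - 1‖ < r) (ha1 : ‖a‖ ≤ 1)
    (n : ℕ) : ‖a ^ n - 1‖ < r := by
  induction n with
  | zero => simpa using hr
  | succ n ih =>
    rw [pow_succ']
    exact norm_mul_sub_one_lt ha ih ha1

theorem norm_prod_sub_one_lt {ι : Type*} (s : Finset ι) {f : ι → O}
    (hf : ∀ i ∈ s, ‖f i - 1‖ < 1) : ‖∏ i ∈ s, f i - 1‖ < 1 := by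
  classical
  induction s using Finset.induction_on with
  | empty => simp
  | insert a s ha ih =>
    rw [Finset.prod_insert ha]
    exact norm_mul_sub_one_lt (hf a (by simp)) (ih fun i hi => hf i (by simp [hi]))
      (norm_eq_one_of_sub_one_lt (hf a (by simp))).le

/-- A geometric sum of `n` terms with ratio close to `1` is close to `n`. -/
theorem norm_geom_sum_sub_natCast_lt {a : O} {r : ℝ} (hr : 0 < r) (ha : ‖a - 1‖ < r)
    (ha1 : ‖a‖ ≤ 1) (n : ℕ) : ‖∑ b ∈ Finset.range n, a ^ b - n‖ < r := by
  induction n with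
  | zero => simpa using hr
  | succ n ih =>
    rw [Finset.sum_range_succ, Nat.cast_succ, add_sub_add_comm]
    exact (IsUltrametricDist.norm_add_le_max _ _).trans_lt
      (max_lt ih (norm_pow_sub_one_lt hr ha ha1 n))

theorem norm_eq_of_norm_sub_lt {a b : O} (h : ‖a - b‖ < ‖b‖) : ‖a‖ = ‖b‖ := by
  have h' := IsUltrametricDist.norm_add_eq_max_of_norm_ne_norm h.ne
  rwa [sub_add_cancel, max_eq_right h.le] at h'

/-- The powers `a ^ (p ^ i)` of an element close to `1` tend to `1`. -/
theorem exists_norm_pow_pow_sub_one_lt {p : ℕ} (hp : ‖(p : O)‖ < 1) {a : O} (ha : ‖a - 1‖ < 1)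
    {r : ℝ} (hr : 0 < r) : ∃ i₀ : ℕ, ∀ i ≥ i₀, ‖a ^ p ^ i - 1‖ < r := by
  -- Passing from `b` to `b ^ p` multiplies `b - 1` by a geometric sum. That sum is within `q` of
  -- `p`, so its norm is at most `q`; each step thus gains one factor `q`.
  set q := max ‖(p : O)‖ ‖a - 1‖ with hq
  have hq1 : q < 1 := max_lt hp ha
  have hq0 : 0 ≤ q := (norm_nonneg _).trans (le_max_left _ _)
  have key : ∀ i : ℕ, ‖a ^ p ^ i - 1‖ ≤ q ^ (i + 1) := by
    intro i
    induction i with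
    | zero => simp [hq]
    | succ i ih =>
      set b := a ^ p ^ i
      have hb : ‖b - 1‖ ≤ q := ih.trans (pow_le_of_le_one hq0 hq1.le (by simp))
      have hb1 : ‖b‖ = 1 := norm_eq_one_of_sub_one_lt (hb.trans_lt hq1)
      have hs : ‖∑ j ∈ Finset.range p, b ^ j‖ ≤ q := by
        have h1 : ‖∑ j ∈ Finset.range p, b ^ j - p‖ ≤ q := by
          refine le_of_forall_gt_imp_ge_of_dense fun r hr => ?_
          exact (norm_geom_sum_sub_natCast_lt (hq0.trans_lt hr) (hb.trans_lt hr) hb1.le p).le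
        have h2 := IsUltrametricDist.norm_add_le_max (∑ j ∈ Finset.range p, b ^ j - (p : O)) p
        rw [sub_add_cancel] at h2
        exact h2.trans (max_le h1 (le_max_left _ _))
      rw [pow_succ p, pow_mul, ← geom_sum_mul, norm_mul, pow_succ', mul_comm]
      rw [mul_comm]
      exact mul_le_mul hs ih (norm_nonneg _) hq0
  obtain ⟨i₀, hi₀⟩ := exists_pow_lt_of_lt_one hr hq1
  refine ⟨i₀, fun i hi => (key i).trans_lt (lt_of_le_of_lt ?_ hi₀)⟩
  exact pow_le_pow_of_le_one hq0 hq1.le (by omega)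

theorem norm_natCast_eq_one_of_prime_ne {p l : ℕ} (hp : p.Prime) (hl : l.Prime) (hpl : l ≠ p)
    (hO : ∀ a : O, ‖a‖ ≤ 1) (hpO : ‖(p : O)‖ < 1) : ‖(l : O)‖ = 1 := by
  refine le_antisymm (hO _) (not_lt.1 fun hlO => ?_)
  have hc : IsCoprime (l : ℤ) (p : ℤ) :=
    Nat.isCoprime_iff_coprime.2 ((Nat.coprime_primes hl hp).2 hpl)
  obtain ⟨u, v, huv⟩ := hc
  have h : (u : O) * l + (v : O) * p = 1 := by exact_mod_cast congrArg (Int.cast : ℤ → O) huv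
  have h2 : ‖(1 : O)‖ < 1 := by
    rw [← h]
    refine (IsUltrametricDist.norm_add_le_max _ _).trans_lt (max_lt ?_ ?_)
    · rw [norm_mul]; exact (mul_le_of_le_one_left (norm_nonneg _) (hO _)).trans_lt hlO
    · rw [norm_mul]; exact (mul_le_of_le_one_left (norm_nonneg _) (hO _)).trans_lt hpO
  rw [norm_one] at h2
  exact h2.false

/-- A ring `S` of functions that behaves like the ring of bounded functions on an open unit disc
with parameter `t`. -/
structure IsDiscRing (S : Subalgebra O (Z → O)) (t : Z → O) : Prop where
  mem : t ∈ S
  norm_sub_lt : ∀ z w, ‖t z - t w‖ < 1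
  injective : Function.Injective t
  exists_div : ∀ f ∈ S, ∀ a, ∃ g ∈ S, ∀ z, f z - f a = (t z - t a) * g z

/-- A self-map of the disc under which the ring of functions is stable. -/
structure IsDiscMap (S : Subalgebra O (Z → O)) (t : Z → O) (F : Z → Z) : Prop where
  comp : ∀ f ∈ S, f ∘ F ∈ S
  exists_div : ∀ f ∈ S, ∀ n, ∃ g ∈ S, ∀ z,
    f (F^[n] z) - f z = (t (F^[n] z) - t z) * g z

variable {S : Subalgebra O (Z → O)} {t : Z → O} {F : Z → Z}

theorem IsDiscMap.comp_iterate (hF : IsDiscMap S t F) {f : Z → O} (hf : f ∈ S) (n : ℕ) :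
    f ∘ F^[n] ∈ S := by
  induction n with
  | zero => simpa using hf
  | succ n ih =>
    rw [Function.iterate_succ, ← Function.comp_assoc]
    exact hF.comp _ ih

theorem IsDiscMap.iterate (hF : IsDiscMap S t F) (R : ℕ) : IsDiscMap S t F^[R] where
  comp _ hf := hF.comp_iterate hf R
  exists_div f hf n := by
    rw [← Function.iterate_mul]
    exact hF.exists_div f hf (R * n)

theorem const_mem (S : Subalgebra O (Z → O)) (c : O) : (fun _ => c) ∈ S :=
  S.algebraMap_mem c

theorem IsDiscRing.norm_sub_lt_one (hS : IsDiscRing S t) (hO : ∀ a : O, ‖a‖ ≤ 1) {f : Z → O}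
    (hf : f ∈ S) (z w : Z) : ‖f z - f w‖ < 1 := by
  obtain ⟨g, -, hg⟩ := hS.exists_div f hf w
  rw [hg, norm_mul]
  exact (mul_le_of_le_one_right (norm_nonneg _) (hO _)).trans_lt (hS.norm_sub_lt z w)

/-- A function of the ring is divisible by the product over finitely many of its zeros. -/
theorem IsDiscRing.exists_eq_prod_mul (hS : IsDiscRing S t) {f : Z → O} (hf : f ∈ S)
    (A : Finset Z) (hA : ∀ a ∈ A, f a = 0) :
    ∃ g ∈ S, ∀ z, f z = (∏ a ∈ A, (t z - t a)) * g z := by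
  classical
  have : Nontrivial O := NormOneClass.nontrivial
  induction A using Finset.induction_on with
  | empty => exact ⟨f, hf, by simp⟩
  | insert a A ha ih =>
    obtain ⟨g, hg, hfg⟩ := ih fun b hb => hA b (by simp [hb])
    have hga : g a = 0 := by
      have h := hA a (by simp)
      rw [hfg, mul_eq_zero, Finset.prod_eq_zero_iff] at h
      rcases h with ⟨b, hb, hab⟩ | h
      · exact absurd (hS.injective (sub_eq_zero.1 hab) ▸ hb) ha
      · exact h
    obtain ⟨g', hg', h'⟩ := hS.exists_div g hg a
    refine ⟨g', hg', fun z => ?_⟩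
    have := h' z
    rw [hga, sub_zero] at this
    rw [hfg, this, Finset.prod_insert ha]
    ring

/-- The factor by which the `n`-th iterate stretches the distance to a fixed point. -/
def iterMultiplier (F : Z → Z) (lam : Z → O) (n : ℕ) (z : Z) : O :=
  ∏ i ∈ Finset.range n, lam (F^[i] z)

theorem iterMultiplier_mem (hF : IsDiscMap S t F) {lam : Z → O} (hlam : lam ∈ S) (n : ℕ) :
    iterMultiplier F lam n ∈ S := by
  have : iterMultiplier F lam n = ∏ i ∈ Finset.range n, lam ∘ F^[i] := by
    ext z; simp [iterMultiplier]
  rw [this]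
  exact Subalgebra.prod_mem _ fun i _ => hF.comp_iterate hlam i

theorem iterMultiplier_add (lam : Z → O) (m n : ℕ) (z : Z) :
    iterMultiplier F lam (m + n) z =
      iterMultiplier F lam m z * iterMultiplier F lam n (F^[m] z) := by
  simp only [iterMultiplier, Finset.prod_range_add, ← Function.iterate_add_apply]
  simp only [add_comm m]

theorem iterMultiplier_apply_fixed {lam : Z → O} {y₀ : Z} (h₀ : F y₀ = y₀) (n : ℕ) :
    iterMultiplier F lam n y₀ = lam y₀ ^ n := by
  simp [iterMultiplier, Function.iterate_fixed h₀]

theorem sub_fixed_iterate {lam : Z → O} {y₀ : Z}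
    (hlam : ∀ z, t (F z) - t y₀ = (t z - t y₀) * lam z) (n : ℕ) (z : Z) :
    t (F^[n] z) - t y₀ = (t z - t y₀) * iterMultiplier F lam n z := by
  induction n with
  | zero => simp [iterMultiplier]
  | succ n ih =>
    rw [Function.iterate_succ_apply', hlam, ih, iterMultiplier, iterMultiplier,
      Finset.prod_range_succ, mul_assoc]

/-- The quotient `(Λ_{q l} - 1) / (Λ_q - 1)`, where `Λ_n` is the multiplier of the `n`-th
iterate. -/
theorem exists_cyclotomic_quotient (hS : IsDiscRing S t) (hF : IsDiscMap S t F)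
    (hO : ∀ a : O, ‖a‖ ≤ 1) {lam : Z → O} (hlamS : lam ∈ S) {y₀ : Z} (h₀ : F y₀ = y₀)
    (hlam : ∀ z, t (F z) - t y₀ = (t z - t y₀) * lam z) (hlam1 : ∀ z, ‖lam z - 1‖ < 1)
    (q l : ℕ) : ∃ Q ∈ S,
      (∀ z, iterMultiplier F lam (q * l) z - 1 = (iterMultiplier F lam q z - 1) * Q z) ∧
      Q y₀ = ∑ b ∈ Finset.range l, (lam y₀ ^ q) ^ b ∧ ∀ z, ‖Q z - l‖ < 1 := by
  set Lam := iterMultiplier F lam q with hLam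
  have hLamS : Lam ∈ S := iterMultiplier_mem hF hlamS q
  have hLam1 : ∀ z, ‖Lam z - 1‖ < 1 := fun z => norm_prod_sub_one_lt _ fun i _ => hlam1 _
  -- The displacement `t ∘ F^q - t` equals `(t - t y₀)(Λ_q - 1)`. Dividing `Λ_q ∘ F^q - Λ_q` by it
  -- shows that `Λ_q ∘ F^q - 1` is `Λ_q - 1` times a function `θ ≡ 1`.
  obtain ⟨η, hηS, hη⟩ := hF.exists_div Lam hLamS q
  have hη' : ∀ z, Lam (F^[q] z) - 1 = (Lam z - 1) * (1 + (t z - t y₀) * η z) := by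
    intro z
    have h1 := hη z
    have h2 := sub_fixed_iterate hlam q z
    have h3 : t (F^[q] z) - t z = (t z - t y₀) * (Lam z - 1) := by
      rw [hLam]; linear_combination h2
    rw [h3] at h1
    linear_combination h1
  set θ : Z → O := fun z => 1 + (t z - t y₀) * η z with hθ
  have hθS : θ ∈ S :=
    S.add_mem S.one_mem (S.mul_mem (S.sub_mem hS.mem (const_mem S (t y₀))) hηS)
  have hθ1 : ∀ z, ‖θ z - 1‖ < 1 := by
    intro z
    rw [hθ]
    simp only [add_sub_cancel_left, norm_mul]
    exact (mul_le_of_le_one_right (norm_nonneg _) (hO _)).trans_lt (hS.norm_sub_lt _ _)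
  induction l with
  | zero =>
    refine ⟨0, S.zero_mem, fun z => by simp [iterMultiplier], by simp, by simp⟩
  | succ l ih =>
    obtain ⟨Q, hQS, hQ, hQ0, hQ1⟩ := ih
    -- From `Λ_{q(l+1)} - 1 = Λ_q (Λ_{ql} ∘ F^q - 1) + (Λ_q - 1)`: divide by `Λ_q - 1`, which
    -- becomes `θ (Λ_q - 1)` under composition with `F^q`.
    refine ⟨Lam * θ * (Q ∘ F^[q]) + 1, S.add_mem (S.mul_mem (S.mul_mem hLamS hθS)
      (hF.comp_iterate hQS q)) S.one_mem, fun z => ?_, ?_, fun z => ?_⟩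
    · have h1 := iterMultiplier_add (F := F) lam q (q * l) z
      rw [show q * (l + 1) = q + q * l by ring, h1]
      have h2 := hQ (F^[q] z)
      rw [hη' z] at h2
      simp only [Pi.add_apply, Pi.mul_apply, Function.comp_apply, Pi.one_apply, hθ]
      rw [← hLam]
      linear_combination Lam z * h2
    · simp only [Pi.add_apply, Pi.mul_apply, Function.comp_apply, Pi.one_apply, hθ,
        Function.iterate_fixed h₀, sub_self, zero_mul, add_zero, mul_one, hQ0]
      rw [hLam, iterMultiplier_apply_fixed h₀, Finset.sum_range_succ', Finset.mul_sum]
      simp [pow_succ']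
    · simp only [Pi.add_apply, Pi.mul_apply, Function.comp_apply, Pi.one_apply, Nat.cast_succ]
      rw [add_sub_add_right_eq_sub]
      refine norm_sub_lt_trans (b := Q (F^[q] z)) ?_ (hQ1 _)
      rw [← sub_one_mul, norm_mul]
      exact (mul_le_of_le_one_right (norm_nonneg _) (hO _)).trans_lt
        (norm_mul_sub_one_lt (hLam1 z) (hθ1 z) (hO _))

/-- Points of large exact period are far from a fixed point of multiplier close to `1`. -/
theorem exists_forall_norm_le_pow_of_multiplier (hS : IsDiscRing S t) (hF : IsDiscMap S t F)
    (hO : ∀ a : O, ‖a‖ ≤ 1) {p : ℕ} (hp : p.Prime) (hpO : ‖(p : O)‖ < 1) (hp0 : (p : O) ≠ 0)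
    {lam : Z → O} (hlamS : lam ∈ S) {y₀ : Z} (h₀ : F y₀ = y₀)
    (hlam : ∀ z, t (F z) - t y₀ = (t z - t y₀) * lam z) (hlam1 : ∀ z, ‖lam z - 1‖ < 1) :
    ∃ k₀ : ℕ, ∀ y, k₀ < Function.minimalPeriod F y →
      ‖(p : O)‖ ≤ ‖t y - t y₀‖ ^ Function.minimalPeriod F y := by
  have hp0' : 0 < ‖(p : O)‖ := norm_pos_iff.2 hp0
  obtain ⟨i₀, hi₀⟩ := exists_norm_pow_pow_sub_one_lt hpO (hlam1 y₀) hp0'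
  -- A period `p ^ (j + 1)` above this bound has `j ≥ i₀`. Then the ratio `λ(y₀) ^ p ^ j` is within
  -- less than `|p|` of 1, as needed for `|Q(y₀)| = |p|`.
  refine ⟨p ^ i₀, fun y hy => ?_⟩
  set k := Function.minimalPeriod F y with hk
  have hk0 : 0 < k := by omega
  have hk1 : 1 < k := lt_of_le_of_lt (Nat.one_le_pow _ _ hp.pos) hy
  have hper : y ∈ Function.periodicPts F := Function.minimalPeriod_pos_iff_mem_periodicPts.1 hk0
  have hne : ∀ i, F^[i] y ≠ y₀ := by
    intro i hi
    have h1 : Function.minimalPeriod F (F^[i] y) = k := Function.minimalPeriod_apply_iterate hper i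
    rw [hi] at h1
    have h2 : Function.minimalPeriod F y₀ = 1 :=
      Function.minimalPeriod_eq_one_iff_isFixedPt.2 h₀
    omega
  -- At a point `w ≠ y₀` of exact period `k = ql` one has `Λ_k(w) = 1`, but `Λ_q(w) ≠ 1` because `0
  -- < q < k`. The quotient must therefore vanish at `w`.
  have hzero : ∀ q l, q * l = k → 0 < q → q < k → ∀ Q : Z → O,
      (∀ z, iterMultiplier F lam (q * l) z - 1 = (iterMultiplier F lam q z - 1) * Q z) →
      ∀ i, Q (F^[i] y) = 0 := by
    intro q l hql hq hqk Q hQ i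
    set w := F^[i] y with hw
    have hwk : Function.minimalPeriod F w = k := Function.minimalPeriod_apply_iterate hper i
    have hw0 : t w - t y₀ ≠ 0 := sub_ne_zero.2 fun h => hne i (hS.injective h)
    have h1 : iterMultiplier F lam (q * l) w - 1 = 0 := by
      have h := sub_fixed_iterate hlam k w
      have hp : F^[k] w = w := by rw [← hwk]; exact Function.iterate_minimalPeriod
      rw [hp] at h
      rw [hql]
      refine (mul_eq_zero.1 ?_).resolve_left hw0
      linear_combination -h
    have h2 : iterMultiplier F lam q w - 1 ≠ 0 := by
      intro h3
      have h := sub_fixed_iterate hlam q w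
      have h4 : F^[q] w = w := hS.injective (by linear_combination h + (t w - t y₀) * h3)
      have h5 := Function.IsPeriodicPt.minimalPeriod_le hq h4
      omega
    have h3 := hQ w
    rw [h1] at h3
    exact (mul_eq_zero.1 h3.symm).resolve_left h2
  -- For a prime `l ≠ p` the congruence `Q ≡ l` makes every value of `Q` a unit, which excludes
  -- zeros.
  have hprime : ∀ l : ℕ, l.Prime → l ∣ k → l = p := by
    intro l hl hlk
    by_contra hlp
    obtain ⟨q, hq⟩ := hlk
    obtain ⟨Q, -, hQ, -, hQ1⟩ := exists_cyclotomic_quotient hS hF hO hlamS h₀ hlam hlam1 q l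
    have hq0 : 0 < q := Nat.pos_of_ne_zero (by rintro rfl; omega)
    have h := hzero q l (by rw [hq, mul_comm]) hq0
      (by rw [hq]; exact lt_mul_of_one_lt_left hq0 hl.one_lt) Q hQ 0
    have h2 := hQ1 (F^[0] y)
    rw [h, zero_sub, norm_neg, norm_natCast_eq_one_of_prime_ne hp hl hlp hO hpO] at h2
    exact h2.false
  obtain ⟨e, hkp⟩ : ∃ e, k = p ^ e :=
    ⟨_, Nat.eq_prime_pow_of_unique_prime_dvd hk0.ne' fun {l} hl hlk => hprime l hl hlk⟩
  have he : i₀ < e := by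
    rw [hkp] at hy
    exact (Nat.pow_lt_pow_iff_right hp.one_lt).1 hy
  obtain ⟨j, rfl⟩ : ∃ j, e = j + 1 := ⟨e - 1, by omega⟩
  obtain ⟨Q, hQS, hQ, hQ0, -⟩ :=
    exists_cyclotomic_quotient hS hF hO hlamS h₀ hlam hlam1 (p ^ j) p
  have hQz := hzero (p ^ j) p (by rw [hkp, pow_succ]) (pow_pos hp.pos _)
    (by rw [hkp]; exact Nat.pow_lt_pow_right hp.one_lt (by omega)) Q hQ
  classical
  obtain ⟨g, -, hg⟩ := hS.exists_eq_prod_mul hQS ((Finset.range k).image fun i => F^[i] y) (by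
    intro a ha
    obtain ⟨i, -, rfl⟩ := Finset.mem_image.1 ha
    exact hQz i)
  have hinj : Set.InjOn (fun i => F^[i] y) (Finset.range k : Set ℕ) := by
    have := Function.iterate_injOn_Iio_minimalPeriod (f := F) (x := y)
    intro a ha b hb hab
    exact this (by simpa using ha) (by simpa using hb) hab
  have hnorm : ‖Q y₀‖ = ‖(p : O)‖ := by
    refine norm_eq_of_norm_sub_lt ?_
    rw [hQ0]
    exact norm_geom_sum_sub_natCast_lt hp0' (hi₀ j (by omega)) (hO _) p
  -- Evaluation at `y₀` of the factorization of `Q` over the orbit of `y`. All `k` factors have the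
  -- same norm, because the multipliers have norm 1.
  rw [← hnorm, hg, Finset.prod_image hinj, norm_mul, norm_prod]
  refine (mul_le_of_le_one_right (by positivity) (hO _)).trans_eq ?_
  rw [← Finset.card_range k, ← Finset.prod_const, Finset.card_range]
  refine Finset.prod_congr rfl fun i _ => ?_
  rw [norm_sub_rev, sub_fixed_iterate hlam, norm_mul, iterMultiplier,
    norm_eq_one_of_sub_one_lt (norm_prod_sub_one_lt _ fun i _ => hlam1 _), mul_one]

/-- For a suitable iterate of a self-map of a disc, points of large exact period are far from
a fixed point. -/
theorem exists_forall_norm_le_pow_minimalPeriod (hS : IsDiscRing S t) (hF : IsDiscMap S t F)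
    (hO : ∀ a : O, ‖a‖ ≤ 1) {p : ℕ} (hp : p.Prime) (hpO : ‖(p : O)‖ < 1) (hp0 : (p : O) ≠ 0)
    {y₀ : Z} (h₀ : F y₀ = y₀) :
    ∃ R k₀ : ℕ, 0 < R ∧ ∀ y, k₀ < Function.minimalPeriod F^[R] y →
      ‖(p : O)‖ ≤ ‖t y - t y₀‖ ^ Function.minimalPeriod F^[R] y := by
  obtain ⟨lam, hlamS, hlam⟩ := hS.exists_div (t ∘ F) (hF.comp t hS.mem) y₀
  simp only [Function.comp_apply, h₀] at hlam
  by_cases hR : ∃ R : ℕ, 0 < R ∧ ‖lam y₀ ^ R - 1‖ < 1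
  · obtain ⟨R, hR0, hR⟩ := hR
    obtain ⟨k₀, hk₀⟩ := exists_forall_norm_le_pow_of_multiplier hS (hF.iterate R) hO hp hpO hp0
      (iterMultiplier_mem hF hlamS R) (Function.iterate_fixed h₀ R)
      (sub_fixed_iterate hlam R) (fun z => by
        refine norm_sub_lt_trans (hS.norm_sub_lt_one hO (iterMultiplier_mem hF hlamS R) z y₀) ?_
        rwa [iterMultiplier_apply_fixed h₀])
    exact ⟨R, k₀, hR0, hk₀⟩
  -- Vacuous case: a point of period `k > 1` would have `Λ_k(y) = 1`. Values of `Λ_k` on the disc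
  -- are congruent, so `λ(y₀) ^ k ≡ 1`, contrary to the case assumption.
  · refine ⟨1, 1, one_pos, fun y hy => (hR ?_).elim⟩
    rw [Function.iterate_one] at hy
    set k := Function.minimalPeriod F y
    have hy0 : t y - t y₀ ≠ 0 := sub_ne_zero.2 fun h => by
      have h1 : F y = y := by rw [hS.injective h, h₀]
      have := Function.IsPeriodicPt.minimalPeriod_le (f := F) (x := y) one_pos h1
      omega
    refine ⟨k, by omega, ?_⟩
    have h := sub_fixed_iterate hlam k y
    have h' : F^[k] y = y := Function.iterate_minimalPeriod
    rw [h'] at h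
    have h1 : iterMultiplier F lam k y = 1 := by
      refine sub_eq_zero.1 ((mul_eq_zero.1 ?_).resolve_left hy0)
      linear_combination -h
    have h2 := hS.norm_sub_lt_one hO (iterMultiplier_mem hF hlamS k) y₀ y
    rwa [h1, iterMultiplier_apply_fixed h₀] at h2

end Dynamics

/-! ### Local parameters from the Jacobian condition and Nakayama's lemma. -/

section LocalParameter

variable {σ A B : Type*} [CommRing A] [CommRing B] [Algebra A B]

theorem aeval_sub_aeval_mem (u v : σ → B) (P : MvPolynomial σ A) :
    aeval u P - aeval v P ∈ Ideal.span (Set.range fun j => u j - v j) := by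
  induction P using MvPolynomial.induction_on with
  | C a => simp
  | add P Q hP hQ =>
    rw [map_add, map_add, add_sub_add_comm]
    exact Ideal.add_mem _ hP hQ
  | mul_X P i hP =>
    simp only [map_mul, aeval_X]
    rw [show aeval u P * u i - aeval v P * v i =
      (aeval u P - aeval v P) * u i + aeval v P * (u i - v i) by ring]
    exact Ideal.add_mem _ (Ideal.mul_mem_right _ _ hP)
      (Ideal.mul_mem_left _ _ (Ideal.subset_span ⟨i, rfl⟩))

/-- First-order Taylor expansion. The remainder lies in the square of the ideal of increments, which
is negligible in the Nakayama argument below. -/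
theorem aeval_sub_aeval_sub_sum_mem [Fintype σ] [DecidableEq σ] (u v : σ → B)
    (P : MvPolynomial σ A) :
    aeval u P - aeval v P - ∑ j, (u j - v j) * aeval v (pderiv j P) ∈
      Ideal.span (Set.range fun j => u j - v j) * Ideal.span (Set.range fun j => u j - v j) := by
  induction P using MvPolynomial.induction_on with
  | C a => simp
  | add P Q hP hQ =>
    convert Ideal.add_mem _ hP hQ using 1
    simp only [map_add, mul_add, Finset.sum_add_distrib]
    ring
  | mul_X P i hP =>
    have h : ∑ j, (u j - v j) * aeval v (pderiv j (P * X i)) =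
        (∑ j, (u j - v j) * aeval v (pderiv j P)) * v i + (u i - v i) * aeval v P := by
      have h1 : ∀ j, (u j - v j) * aeval v (pderiv j (P * X i)) =
          (u j - v j) * aeval v (pderiv j P) * v i +
            if j = i then (u i - v i) * aeval v P else 0 := by
        intro j
        rw [Derivation.leibniz, pderiv_X]
        split_ifs with hj
        · subst hj; simp; ring
        · rw [Pi.single_eq_of_ne (fun h => hj h.symm)]; simp; ring
      simp_rw [h1, Finset.sum_add_distrib, Finset.sum_mul]
      simp
    rw [h, map_mul, map_mul, aeval_X, aeval_X]
    rw [show aeval u P * u i - aeval v P * v i -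
      ((∑ j, (u j - v j) * aeval v (pderiv j P)) * v i + (u i - v i) * aeval v P) =
      (aeval u P - aeval v P - ∑ j, (u j - v j) * aeval v (pderiv j P)) * v i +
        (aeval u P - aeval v P) * (u i - v i) by ring]
    exact Ideal.add_mem _ (Ideal.mul_mem_right _ _ hP)
      (Ideal.mul_mem_mul (aeval_sub_aeval_mem u v P) (Ideal.subset_span ⟨i, rfl⟩))

/-- Two solutions `u`, `v` of a system of equations of maximal rank: the differences of their
coordinates are multiples of the difference of one coordinate. -/
theorem sub_mem_span_singleton [Fintype σ] [DecidableEq σ] {u v : σ → B} {i j₀ : σ}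
    (hi : u i = v i) {n : Ideal B} (hn : n ≤ Ideal.jacobson ⊥) (huv : ∀ j, u j - v j ∈ n)
    (g : σ → MvPolynomial σ A)
    (hgu : ∀ j, j ≠ i → j ≠ j₀ → aeval u (g j) = 0)
    (hgv : ∀ j, j ≠ i → j ≠ j₀ → aeval v (g j) = 0)
    (hder : ∀ j, j ≠ i → j ≠ j₀ → ∀ l, l ≠ i → l ≠ j₀ →
      aeval v (pderiv l (g j)) - (if l = j then 1 else 0) ∈ n) (j : σ) :
    u j - v j ∈ Ideal.span {u j₀ - v j₀} := by
  set M := Ideal.span (Set.range fun j => u j - v j) with hM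
  have hmem : ∀ j, u j - v j ∈ M := fun j => Ideal.subset_span ⟨j, rfl⟩
  have hMn : M ≤ n := Ideal.span_le.2 (by rintro _ ⟨j, rfl⟩; exact huv j)
  suffices h : M ≤ Ideal.span {u j₀ - v j₀} from h (hmem j)
  -- Nakayama: it suffices to generate `M` modulo `n • M`. Linearizing the equation `g j`, whose
  -- gradient is nearly the `j`-th unit vector off `j₀`, expresses `u j - v j` through `u j₀ - v j₀`
  -- modulo `n • M`.
  refine Submodule.le_of_le_smul_of_le_jacobson_bot (I := n)
    (Submodule.fg_span (Set.finite_range _)) hn ?_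
  rw [hM, Ideal.span_le]
  rintro _ ⟨j, rfl⟩
  change u j - v j ∈ Ideal.span {u j₀ - v j₀} ⊔ n • M
  have hτ : u j₀ - v j₀ ∈ Ideal.span {u j₀ - v j₀} ⊔ n • M :=
    Ideal.mem_sup_left (Ideal.mem_span_singleton_self _)
  by_cases hji : j = i
  · rw [hji, hi, sub_self]; exact Ideal.zero_mem _
  by_cases hj0 : j = j₀
  · rw [hj0]; exact hτ
  have h1 := aeval_sub_aeval_sub_sum_mem u v (g j)
  rw [hgu j hji hj0, hgv j hji hj0, sub_zero, zero_sub, neg_mem_iff] at h1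
  have h2 : ∑ l, (u l - v l) * aeval v (pderiv l (g j)) ∈ Ideal.span {u j₀ - v j₀} ⊔ n • M :=
    Ideal.mem_sup_right (Ideal.mul_mono_left hMn h1)
  have h3 : u j - v j = ∑ l, (u l - v l) * aeval v (pderiv l (g j)) -
      ∑ l, (u l - v l) * (aeval v (pderiv l (g j)) - if l = j then 1 else 0) := by
    simp [mul_sub, Finset.sum_sub_distrib]
  rw [h3]
  refine Ideal.sub_mem _ h2 (Ideal.sum_mem _ fun l _ => ?_)
  by_cases hli : l = i
  · rw [hli, hi, sub_self, zero_mul]; exact Ideal.zero_mem _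
  by_cases hl0 : l = j₀
  · rw [hl0]; exact Ideal.mul_mem_right _ _ hτ
  · rw [mul_comm]
    exact Ideal.mem_sup_right (Ideal.mul_mem_mul (hder j hji hj0 l hli hl0) (hmem l))

end LocalParameter

/-- The Jacobian condition provides a coordinate and equations whose gradients form, apart from
that coordinate, the standard basis. -/
theorem exists_gradient_eq_single {K : Type*} [Field K] {N : ℕ}
    {I : Ideal (MvPolynomial (Fin (N + 1)) K)} {i : Fin (N + 1)} {X : Fin (N + 1) → K}
    (h : Module.finrank K (Submodule.span K (jacobianRow i X '' (I : Set _))) + 1 = N) :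
    ∃ j₀, ∃ g : Fin (N + 1) → MvPolynomial (Fin (N + 1)) K, (∀ j, g j ∈ I) ∧
      ∀ j, j ≠ i → j ≠ j₀ → ∀ l, l ≠ i → l ≠ j₀ →
        eval (fun k => X k / X i) (pderiv l (g j)) = if l = j then 1 else 0 := by
  classical
  let J : MvPolynomial (Fin (N + 1)) K →ₗ[K] ({j : Fin (N + 1) // j ≠ i} → K) :=
    { toFun := jacobianRow i X
      map_add' := fun f g => by ext j; simp [jacobianRow]
      map_smul' := fun c f => by ext j; simp [jacobianRow, smul_eval] }
  set W := Submodule.span K (jacobianRow i X '' (I : Set _)) with hW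
  have hWI : W = (I.restrictScalars K).map J := by
    rw [hW, ← Submodule.span_eq ((I.restrictScalars K).map J)]
    rfl
  have hcard : Module.finrank K ({j : Fin (N + 1) // j ≠ i} → K) = N := by
    rw [Module.finrank_fintype_fun_eq_card, Fintype.card_subtype_compl]
    simp
  -- The row space has dimension `N - 1` in an `N`-dimensional space, so it misses some unit vector,
  -- which then spans a complement. Modulo that vector every other unit vector is a gradient.
  obtain ⟨j₀, hj₀⟩ : ∃ j₀ : {j : Fin (N + 1) // j ≠ i}, (Pi.single j₀ 1 : _ → K) ∉ W := by
    by_contra! hall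
    have : W = ⊤ := by
      rw [eq_top_iff, ← (Pi.basisFun K {j : Fin (N + 1) // j ≠ i}).span_eq, Submodule.span_le]
      rintro _ ⟨j, rfl⟩
      simpa using hall j
    rw [this, finrank_top, hcard] at h
    omega
  have htop : W ⊔ Submodule.span K {(Pi.single j₀ 1 : _ → K)} = ⊤ := by
    refine Submodule.eq_top_of_finrank_eq ?_
    have hlt : W < W ⊔ Submodule.span K {(Pi.single j₀ 1 : _ → K)} := by
      refine lt_of_le_of_ne le_sup_left fun heq => hj₀ ?_
      rw [heq]
      exact Submodule.mem_sup_right (Submodule.mem_span_singleton_self _)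
    have h1 := Submodule.finrank_lt_finrank_of_lt hlt
    have h2 := Submodule.finrank_le (W ⊔ Submodule.span K {(Pi.single j₀ 1 : _ → K)})
    omega
  have hg : ∀ j : Fin (N + 1), ∃ g ∈ I, j ≠ i → j ≠ j₀.1 → ∀ l, l ≠ i → l ≠ j₀.1 →
      eval (fun k => X k / X i) (pderiv l g) = if l = j then 1 else 0 := by
    intro j
    by_cases hji : j = i
    · exact ⟨0, I.zero_mem, fun h => (h hji).elim⟩
    have hmem : (Pi.single ⟨j, hji⟩ 1 : {j : Fin (N + 1) // j ≠ i} → K) ∈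
        W ⊔ Submodule.span K {(Pi.single j₀ 1 : _ → K)} := by rw [htop]; trivial
    obtain ⟨w, hw, z, hz, hwz⟩ := Submodule.mem_sup.1 hmem
    obtain ⟨c, rfl⟩ := Submodule.mem_span_singleton.1 hz
    rw [hWI] at hw
    obtain ⟨g, hgI, rfl⟩ := hw
    refine ⟨g, hgI, fun _ _ l hli hl0 => ?_⟩
    have h3 := congrFun hwz ⟨l, hli⟩
    have h4 : (⟨l, hli⟩ : {j : Fin (N + 1) // j ≠ i}) ≠ j₀ := fun h => hl0 (congrArg Subtype.val h)
    simp only [Pi.add_apply, Pi.smul_apply, Pi.single_eq_of_ne h4, smul_zero, add_zero] at h3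
    have h5 : J g ⟨l, hli⟩ = eval (fun k => X k / X i) (pderiv l g) := rfl
    rw [← h5, h3, Pi.single_apply]
    simp
  choose g hgI hg using hg
  exact ⟨j₀, g, hgI, hg⟩

/-! ### The local ring at a nonsingular point. -/

section LocalRing

theorem exists_mul_eq_mul_of_mem_span {B : Type*} [CommRing B] [IsDomain B] (q : Ideal B)
    [q.IsPrime] {a b : B} (h : algebraMap B (Localization.AtPrime q) a ∈
      Ideal.span {algebraMap B (Localization.AtPrime q) b}) :
    ∃ s ∉ q, ∃ c, s * a = b * c := by
  obtain ⟨w, hw⟩ := Ideal.mem_span_singleton'.1 h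
  obtain ⟨c, s, rfl⟩ := IsLocalization.exists_mk'_eq q.primeCompl w
  refine ⟨s, s.2, c, IsLocalization.injective (Localization.AtPrime q)
    q.primeCompl_le_nonZeroDivisors ?_⟩
  rw [map_mul, ← hw, map_mul, mul_comm, mul_right_comm, IsLocalization.mk'_spec, mul_comm]

/-- A coordinate generates the maximal ideal of a local ring in which the equations `g` of
maximal rank are satisfied, and each nonzero element divides a power of that coordinate. -/
theorem uniformizer_of_gradient {σ K L : Type*} [Fintype σ] [DecidableEq σ] [Field K]
    [CommRing L] [IsLocalRing L] [IsNoetherianRing L] [Algebra K L]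
    (ι : MvPolynomial σ K →ₐ[K] L) {x : σ → K}
    (hιm : ∀ f, ι f ∈ IsLocalRing.maximalIdeal L ↔ eval x f = 0)
    (hgen : IsLocalRing.maximalIdeal L ≤ Ideal.span (ι '' {f | eval x f = 0}))
    {i j₀ : σ} (hi : ι (X i - C (x i)) = 0) (g : σ → MvPolynomial σ K) (hg : ∀ j, ι (g j) = 0)
    (hder : ∀ j, j ≠ i → j ≠ j₀ → ∀ l, l ≠ i → l ≠ j₀ →
      eval x (pderiv l (g j)) = if l = j then 1 else 0) :
    (∀ j, ι (X j - C (x j)) ∈ Ideal.span {ι (X j₀ - C (x j₀))}) ∧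
    ∀ w : L, w ≠ 0 → ∃ e : ℕ, ι (X j₀ - C (x j₀)) ^ e ∈ Ideal.span {w} := by
  let u : σ → L := fun j => ι (X j)
  let v : σ → L := fun j => algebraMap K L (x j)
  have hu : ∀ f, aeval u f = ι f := fun f => by
    have : aeval u = ι := by ext j; simp [u]
    rw [this]
  have hv : ∀ f, aeval v f = algebraMap K L (eval x f) := fun f => by
    rw [← aeval_eq_eval, ← aeval_algebraMap_apply]
    rfl
  have huv : ∀ j, u j - v j = ι (X j - C (x j)) := fun j => by
    rw [map_sub, ← algebraMap_eq, AlgHom.commutes]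
  -- The two solutions compared are the generic point `u` and the constant point `v = x`.
  have hspan : ∀ j, u j - v j ∈ Ideal.span {u j₀ - v j₀} := by
    refine sub_mem_span_singleton (A := K) (i := i) ?_ (IsLocalRing.maximalIdeal_le_jacobson ⊥)
      (fun j => ?_) g (fun j _ _ => ?_) (fun j _ _ => ?_) (fun j hj hj0 l hl hl0 => ?_)
    · rw [← sub_eq_zero, huv, hi]
    · rw [huv, hιm]; simp
    · rw [hu, hg j]
    · have h := (hιm (g j)).1 (by rw [hg j]; exact Ideal.zero_mem _)
      rw [hv, h, map_zero]
    · rw [hv, hder j hj hj0 l hl hl0]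
      split_ifs <;> simp
  have hmax : IsLocalRing.maximalIdeal L = Ideal.span {u j₀ - v j₀} := by
    refine le_antisymm (hgen.trans (Ideal.span_le.2 ?_)) ?_
    · rintro _ ⟨f, hf, rfl⟩
      have h1 := aeval_sub_aeval_mem u v f
      rw [hu, hv, show eval x f = 0 from hf, map_zero, sub_zero] at h1
      refine (Ideal.span_le.2 ?_ : _ ≤ Ideal.span {u j₀ - v j₀}) h1
      rintro _ ⟨j, rfl⟩
      exact hspan j
    · rw [Ideal.span_singleton_le_iff_mem, huv, hιm]
      simp
  refine ⟨fun j => ?_, fun P hP => ?_⟩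
  · rw [← huv, ← huv]; exact hspan j
  -- By Krull's intersection theorem there is a last power of the maximal ideal containing `P`. The
  -- cofactor of the corresponding power of the coordinate is then a unit.
  · have hex : ∃ e : ℕ, P ∉ IsLocalRing.maximalIdeal L ^ e := by
      by_contra! hall
      have h1 := Ideal.iInf_pow_eq_bot_of_isLocalRing (IsLocalRing.maximalIdeal L)
        Ideal.IsPrime.ne_top'
      have h2 : P ∈ ⨅ e : ℕ, IsLocalRing.maximalIdeal L ^ e := by
        rw [Ideal.mem_iInf]; exact hall
      rw [h1] at h2
      exact hP h2
    classical
    obtain ⟨e, he, hmin⟩ : ∃ e, P ∈ IsLocalRing.maximalIdeal L ^ e ∧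
        P ∉ IsLocalRing.maximalIdeal L ^ (e + 1) := by
      have h0 : Nat.find hex ≠ 0 := fun h0 => by
        have := Nat.find_spec hex
        rw [h0, pow_zero, Ideal.one_eq_top] at this
        exact this trivial
      refine ⟨Nat.find hex - 1, ?_, ?_⟩
      · exact not_not.1 (Nat.find_min hex (by omega))
      · rw [Nat.sub_add_cancel (by omega)]; exact Nat.find_spec hex
    rw [hmax, Ideal.span_singleton_pow, Ideal.mem_span_singleton'] at he
    obtain ⟨w, hw⟩ := he
    have hwu : IsUnit w := by
      by_contra hwu
      refine hmin ?_
      rw [← hw, pow_succ']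
      refine Ideal.mul_mem_mul ((IsLocalRing.mem_maximalIdeal w).2 hwu) ?_
      rw [hmax]
      exact Ideal.pow_mem_pow (Ideal.mem_span_singleton_self _) e
    obtain ⟨w, rfl⟩ := hwu
    refine ⟨e, Ideal.mem_span_singleton'.2 ⟨↑w⁻¹, ?_⟩⟩
    rw [← huv, ← hw, Units.inv_mul_cancel_left]

/-- At a nonsingular point of an irreducible affine curve all nonzero functions are, up to local
units, powers of a coordinate, and the local ring has that coordinate as a uniformizer. -/
theorem exists_uniformizer_relations {σ K : Type*} [Fintype σ] [DecidableEq σ] [Field K]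
    (a : Ideal (MvPolynomial σ K)) [a.IsPrime] {x : σ → K} (hx : ∀ f ∈ a, eval x f = 0)
    {i j₀ : σ} (hi : X i - C (x i) ∈ a) (g : σ → MvPolynomial σ K) (hg : ∀ j, g j ∈ a)
    (hder : ∀ j, j ≠ i → j ≠ j₀ → ∀ l, l ≠ i → l ≠ j₀ →
      eval x (pderiv l (g j)) = if l = j then 1 else 0) :
    (∀ j, ∃ s b, eval x s ≠ 0 ∧ s * (X j - C (x j)) - (X j₀ - C (x j₀)) * b ∈ a) ∧
    ∀ P ∉ a, ∃ s b, ∃ e : ℕ, eval x s ≠ 0 ∧ s * (X j₀ - C (x j₀)) ^ e - P * b ∈ a := by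
  let ev : MvPolynomial σ K ⧸ a →+* K := Ideal.Quotient.lift a (eval x) hx
  let q : Ideal (MvPolynomial σ K ⧸ a) := RingHom.ker ev
  have hq : q.IsPrime := RingHom.ker_isPrime ev
  have : IsNoetherianRing (Localization.AtPrime q) :=
    IsLocalization.isNoetherianRing q.primeCompl _ inferInstance
  let ι : MvPolynomial σ K →ₐ[K] Localization.AtPrime q :=
    (IsScalarTower.toAlgHom K (MvPolynomial σ K ⧸ a) _).comp (Ideal.Quotient.mkₐ K a)
  have hι : ∀ f, ι f = algebraMap _ (Localization.AtPrime q) (Ideal.Quotient.mk a f) :=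
    fun f => rfl
  have hι0 : ∀ f, ι f = 0 ↔ f ∈ a := fun f => by
    rw [hι, ← Ideal.Quotient.eq_zero_iff_mem, (injective_iff_map_eq_zero' _).1
      (IsLocalization.injective (Localization.AtPrime q) q.primeCompl_le_nonZeroDivisors)]
  have hιm : ∀ f, ι f ∈ IsLocalRing.maximalIdeal (Localization.AtPrime q) ↔ eval x f = 0 :=
    fun f => by
      rw [hι, IsLocalization.AtPrime.to_map_mem_maximal_iff (Localization.AtPrime q) q]
      rfl
  have hlift : ∀ f h, ι f ∈ Ideal.span {ι h} → ∃ s b, eval x s ≠ 0 ∧ s * f - h * b ∈ a := by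
    intro f h hfh
    rw [hι, hι] at hfh
    obtain ⟨s, hs, c, hc⟩ := exists_mul_eq_mul_of_mem_span q hfh
    obtain ⟨s, rfl⟩ := Ideal.Quotient.mk_surjective s
    obtain ⟨c, rfl⟩ := Ideal.Quotient.mk_surjective c
    refine ⟨s, c, hs, ?_⟩
    rw [← Ideal.Quotient.eq_zero_iff_mem, map_sub, map_mul, map_mul, hc, sub_self]
  have hgen : IsLocalRing.maximalIdeal (Localization.AtPrime q) ≤
      Ideal.span (ι '' {f | eval x f = 0}) := by
    rw [← Localization.AtPrime.map_eq_maximalIdeal, Ideal.map_le_iff_le_comap]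
    intro f hf
    obtain ⟨f, rfl⟩ := Ideal.Quotient.mk_surjective f
    exact Ideal.subset_span ⟨f, hf, rfl⟩
  obtain ⟨h1, h2⟩ := uniformizer_of_gradient (L := Localization.AtPrime q) ι hιm hgen ((hι0 _).2 hi) g
    (fun j => (hι0 _).2 (hg j)) hder
  refine ⟨fun j => hlift _ _ (h1 j), fun P hP => ?_⟩
  obtain ⟨e, he⟩ := h2 (ι P) (mt (hι0 P).1 hP)
  rw [← map_pow] at he
  obtain ⟨s, b, hs, hsb⟩ := hlift _ _ he
  exact ⟨s, b, e, hs, hsb⟩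

end LocalRing

/-! ### Homogeneous polynomials and dehomogenization. -/

section Homogeneous

theorem aeval_mul_of_isHomogeneous {σ K L : Type*} [Fintype σ] [CommRing K] [CommRing L]
    [Algebra K L] {P : MvPolynomial σ K} {e : ℕ} (hP : P.IsHomogeneous e) (c : L) (g : σ → L) :
    aeval (fun j => c * g j) P = c ^ e * aeval g P := by
  rw [aeval_def, aeval_def, eval₂_eq', eval₂_eq', Finset.mul_sum]
  refine Finset.sum_congr rfl fun d hd => ?_
  have h : ∑ i, d i = e := by
    rw [← hP (mem_support_iff.1 hd), Finsupp.weight_apply, Finsupp.sum_fintype _ _ (by simp)]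
    simp
  simp_rw [mul_pow]
  rw [Finset.prod_mul_distrib, Finset.prod_pow_eq_pow_sum, h]
  ring

theorem eval_mul_of_isHomogeneous {σ K : Type*} [Fintype σ] [CommRing K]
    {P : MvPolynomial σ K} {e : ℕ} (hP : P.IsHomogeneous e) (c : K) (g : σ → K) :
    eval (fun j => c * g j) P = c ^ e * eval g P := by
  simpa only [aeval_eq_eval] using aeval_mul_of_isHomogeneous hP c g

theorem exists_isHomogeneous_eval_eq {σ K : Type*} [CommRing K] (i : σ) (f : MvPolynomial σ K) :
    ∃ (e : ℕ) (P : MvPolynomial σ K), P.IsHomogeneous e ∧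
      ∀ z : σ → K, z i = 1 → eval z P = eval z f := by
  refine ⟨f.totalDegree, ∑ d ∈ Finset.range (f.totalDegree + 1),
    homogeneousComponent d f * X i ^ (f.totalDegree - d), ?_, fun z hz => ?_⟩
  · refine IsHomogeneous.sum _ _ _ fun d hd => ?_
    have h := (homogeneousComponent_isHomogeneous d f).mul
      (isHomogeneous_X_pow (R := K) i (f.totalDegree - d))
    rwa [Nat.add_sub_cancel' (Nat.lt_succ_iff.1 (Finset.mem_range.1 hd))] at h
  · conv_rhs => rw [← sum_homogeneousComponent f]
    simp [hz]

end Homogeneous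

/-! ### Affine charts and isolated zeros on a smooth curve. -/

namespace ProjCurve

section Field

variable {K : Type*} [Field K] {N : ℕ} (C : ProjCurve K N)

/-- The homogeneous coordinate vectors of the points of the curve. -/
def cone : Set (Fin (N + 1) → K) :=
  {X | ∃ hX : X ≠ 0, Projectivization.mk K X hX ∈ C.carrier}

theorem mem_ideal_iff {f : MvPolynomial (Fin (N + 1)) K} :
    f ∈ C.ideal ↔ ∀ X ∈ C.cone, eval X f = 0 :=
  ⟨fun h X hX => h X hX.1 hX.2, fun h X hX hC => h X ⟨hX, hC⟩⟩

variable {C} in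
theorem mul_mem_cone {X : Fin (N + 1) → K} (hX : X ∈ C.cone) {c : K} (hc : c ≠ 0) :
    (fun j => c * X j) ∈ C.cone := by
  have h0 : (fun j => c * X j) ≠ 0 := fun h => hX.1 (by
    ext j
    exact (mul_eq_zero.1 (congrFun h j)).resolve_left hc)
  refine ⟨h0, ?_⟩
  have : Projectivization.mk K (fun j => c * X j) h0 = Projectivization.mk K X hX.1 :=
    (Projectivization.mk_eq_mk_iff' K _ _ _ _).2 ⟨c, rfl⟩
  rw [this]
  exact hX.2

/-- The points of the curve in the chart `T_i = 1`. -/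
def affinePart (i : Fin (N + 1)) : Set (Fin (N + 1) → K) :=
  {z | z i = 1 ∧ z ∈ C.cone}

-- `X i * P` vanishes on the whole cone: by homogeneity where `X i ≠ 0`, trivially elsewhere.
-- Primality then removes `X i`, which is nonzero at `x`.
variable {C} in
theorem mem_ideal_of_forall_affinePart {i : Fin (N + 1)} {x : Fin (N + 1) → K}
    (hx : x ∈ C.affinePart i) {P : MvPolynomial (Fin (N + 1)) K} {e : ℕ} (hP : P.IsHomogeneous e)
    (h : ∀ z ∈ C.affinePart i, eval z P = 0) : P ∈ C.ideal := by
  have hXi : (X i : MvPolynomial (Fin (N + 1)) K) ∉ C.ideal := fun hXi => by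
    have := C.mem_ideal_iff.1 hXi x hx.2
    rw [eval_X, hx.1] at this
    exact one_ne_zero this
  refine (C.isPrime.mem_or_mem (?_ : X i * P ∈ C.ideal)).resolve_left hXi
  rw [mem_ideal_iff]
  intro X hX
  rw [map_mul, eval_X]
  by_cases hXi : X i = 0
  · rw [hXi, zero_mul]
  · have h1 := h (fun j => (X i)⁻¹ * X j)
      ⟨inv_mul_cancel₀ hXi, mul_mem_cone hX (inv_ne_zero hXi)⟩
    rw [eval_mul_of_isHomogeneous hP, mul_eq_zero] at h1
    rw [h1.resolve_left (pow_ne_zero _ (inv_ne_zero hXi)), mul_zero]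

-- Homogenizing with respect to `T_i` does not change values on the chart, so primality is inherited
-- from `C.ideal`.
variable {C} in
theorem isPrime_vanishingIdeal_affinePart {i : Fin (N + 1)} {x : Fin (N + 1) → K}
    (hx : x ∈ C.affinePart i) : (vanishingIdeal K (C.affinePart i)).IsPrime := by
  refine ⟨(Ideal.ne_top_iff_one _).2 fun h => ?_, fun {f g} hfg => ?_⟩
  · simpa using mem_vanishingIdeal_iff.1 h x hx
  · obtain ⟨d, P, hP, hPf⟩ := exists_isHomogeneous_eval_eq i f
    obtain ⟨e, Q, hQ, hQg⟩ := exists_isHomogeneous_eval_eq i g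
    have hPQ : P * Q ∈ C.ideal := by
      refine mem_ideal_of_forall_affinePart hx (hP.mul hQ) fun z hz => ?_
      have := mem_vanishingIdeal_iff.1 hfg z hz
      rwa [aeval_eq_eval, map_mul, ← hPf z hz.1, ← hQg z hz.1, ← map_mul] at this
    rcases C.isPrime.mem_or_mem hPQ with h | h
    · refine Or.inl (mem_vanishingIdeal_iff.2 fun z hz => ?_)
      rw [aeval_eq_eval, ← hPf z hz.1]
      exact C.mem_ideal_iff.1 h z hz.2
    · refine Or.inr (mem_vanishingIdeal_iff.2 fun z hz => ?_)
      rw [aeval_eq_eval, ← hQg z hz.1]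
      exact C.mem_ideal_iff.1 h z hz.2

end Field

/-- The zeros on a smooth curve of a form that does not vanish identically on the curve do not
accumulate at any point. -/
theorem exists_forall_eq_of_eval_eq_zero {K : Type*} [NormedField K] {N : ℕ} {C : ProjCurve K N}
    (hC : C.IsSmooth) {i : Fin (N + 1)} {x : Fin (N + 1) → K} (hx : x ∈ C.affinePart i)
    {P : MvPolynomial (Fin (N + 1)) K} {e : ℕ} (hP : P.IsHomogeneous e) (hPC : P ∉ C.ideal) :
    ∃ ε > 0, ∀ z ∈ C.affinePart i, (∀ j, ‖z j - x j‖ < ε) → eval z P = 0 → z = x := by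
  set a := vanishingIdeal K (C.affinePart i) with ha
  have ha_mem : ∀ f, f ∈ a ↔ ∀ z ∈ C.affinePart i, eval z f = 0 := fun f => by
    rw [ha, mem_vanishingIdeal_iff]; simp only [aeval_eq_eval]
  have : a.IsPrime := isPrime_vanishingIdeal_affinePart hx
  have hPa : P ∉ a := fun h =>
    hPC (mem_ideal_of_forall_affinePart hx hP ((ha_mem P).1 h))
  have hxi : x i ≠ 0 := by rw [hx.1]; exact one_ne_zero
  obtain ⟨j₀, g, hg, hder⟩ := exists_gradient_eq_single (hC x hx.2.1 hx.2.2 i hxi)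
  simp only [hx.1, div_one] at hder
  obtain ⟨h1, h2⟩ := exists_uniformizer_relations a (x := x) (i := i) (j₀ := j₀)
    (fun f hf => (ha_mem f).1 hf x hx)
    ((ha_mem _).2 fun z hz => by simp [hz.1, hx.1]) g
    (fun j => (ha_mem _).2 fun z hz => C.mem_ideal_iff.1 (hg j) z hz.2) hder
  -- With `τ = X j₀ - x j₀`, the relation `s τ^m = P b` holds on the curve and `s(x) ≠ 0`. Near `x`
  -- a zero of `P` is thus a zero of `τ`, and the relations `S j (X j - x j) = τ B j` then fix all
  -- coordinates.
  obtain ⟨s, b, m, hs, hsb⟩ := h2 P hPa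
  choose S B hS hSB using h1
  have hev : ∀ᶠ z in nhds x, eval z s ≠ 0 ∧ ∀ j, eval z (S j) ≠ 0 := by
    refine ((continuous_eval s).continuousAt.eventually_ne hs).and
      (Filter.eventually_all.2 fun j => (continuous_eval (S j)).continuousAt.eventually_ne (hS j))
  obtain ⟨ε, hε, hball⟩ := Metric.eventually_nhds_iff.1 hev
  refine ⟨ε, hε, fun z hz hzx hzP => ?_⟩
  obtain ⟨hs', hS'⟩ := hball ((dist_pi_lt_iff hε).2 fun j => by rw [dist_eq_norm]; exact hzx j)
  have h3 := (ha_mem _).1 hsb z hz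
  simp only [map_sub, map_mul, map_pow, eval_X, eval_C, hzP, zero_mul, sub_zero] at h3
  have h4 : z j₀ - x j₀ = 0 := by
    by_contra h
    exact mul_ne_zero hs' (pow_ne_zero m h) h3
  ext j
  have h5 := (ha_mem _).1 (hSB j) z hz
  simp only [map_sub, map_mul, eval_X, eval_C, h4, zero_mul, sub_zero, mul_eq_zero,
    hS' j, false_or] at h5
  exact sub_eq_zero.1 h5

end ProjCurve

/-! ### Representing forms, composition and degree. -/

namespace ProjCurve

section Representations

variable {K : Type*} [Field K] {N : ℕ} {C : ProjCurve K N}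

theorem eval_bind₁ {σ τ R : Type*} [CommRing R] (X : τ → R) (G : σ → MvPolynomial τ R)
    (P : MvPolynomial σ R) : eval X (bind₁ G P) = eval (fun i => eval X (G i)) P := by
  rw [← aeval_eq_eval, ← aeval_eq_eval, aeval_bind₁]

theorem represents_id {X : Fin (N + 1) → K} (hX : X ∈ C.cone) :
    C.Represents id (fun j => MvPolynomial.X j) where
  areForms := ⟨1, fun i => isHomogeneous_X _ i⟩
  nonzero := by
    by_contra! h
    refine hX.1 (funext fun j => ?_)
    simpa using C.mem_ideal_iff.1 (h j) X hX
  apply_eq := fun Y hY hC hG => by simp only [eval_X]; rfl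

theorem Represents.eval_mem_cone {φ : C.carrier → C.carrier}
    {G : Fin (N + 1) → MvPolynomial (Fin (N + 1)) K} (hG : C.Represents φ G)
    {X : Fin (N + 1) → K} (hX : X ∈ C.cone) (hGX : (fun i => eval X (G i)) ≠ 0) :
    (fun i => eval X (G i)) ∈ C.cone := by
  refine ⟨hGX, ?_⟩
  rw [← hG.apply_eq X hX.1 hX.2 hGX]
  exact Subtype.prop _

/-- Nonvanishing at the one point `X` ensures that the composed forms do not vanish identically on
the curve. -/
theorem Represents.comp {φ ψ : C.carrier → C.carrier}
    {G H : Fin (N + 1) → MvPolynomial (Fin (N + 1)) K} (hG : C.Represents φ G)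
    (hH : C.Represents ψ H) {X : Fin (N + 1) → K} (hX : X ∈ C.cone)
    (hGH : (fun j => eval (fun i => eval X (G i)) (H j)) ≠ 0) :
    C.Represents (ψ ∘ φ) (fun j => bind₁ G (H j)) where
  areForms := by
    obtain ⟨e, he⟩ := hG.areForms
    obtain ⟨e', he'⟩ := hH.areForms
    exact ⟨e * e', fun i => (he' i).aeval G he⟩
  nonzero := by
    by_contra! h
    refine hGH (funext fun j => ?_)
    rw [← eval_bind₁]
    exact C.mem_ideal_iff.1 (h j) X hX
  apply_eq := by
    intro Y hY hC hΘ
    simp only [eval_bind₁] at hΘ ⊢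
    by_cases hGY : (fun i => eval Y (G i)) = 0
    -- If `G` vanishes at `Y` but `H(G(Y)) ≠ 0`, then `H` has degree 0. Hence `ψ` is constant, and
    -- the value of `φ` at `Y` is irrelevant.
    · obtain ⟨e', he'⟩ := hH.areForms
      have hconst : ∀ W : Fin (N + 1) → K, ∀ j, eval W (H j) = eval 0 (H j) := by
        have he0 : e' = 0 := by
          by_contra h0
          refine hΘ (funext fun j => ?_)
          have h := eval_mul_of_isHomogeneous (he' j) 0 (0 : Fin (N + 1) → K)
          rw [zero_pow h0, zero_mul] at h
          rw [hGY, Pi.zero_apply, ← h]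
          congr
          ext; simp
        intro W j
        have h := eval_mul_of_isHomogeneous (he' j) 0 W
        rw [he0, pow_zero, one_mul] at h
        rw [← h]
        congr
        ext; simp
      obtain ⟨W, hW, hφ⟩ : ∃ W, ∃ hW : W ≠ 0, (φ ⟨Projectivization.mk K Y hY, hC⟩).1 =
          Projectivization.mk K W hW :=
        ⟨_, Projectivization.rep_nonzero _, (Projectivization.mk_rep _).symm⟩
      have hWC : Projectivization.mk K W hW ∈ C.carrier := hφ ▸ Subtype.prop _
      have hφ' : φ ⟨Projectivization.mk K Y hY, hC⟩ = ⟨Projectivization.mk K W hW, hWC⟩ :=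
        Subtype.ext hφ
      have heq : (fun j => eval W (H j)) = fun j => eval (fun i => eval Y (G i)) (H j) := by
        ext j
        rw [hconst W, hconst (fun i => eval Y (G i))]
      have := hH.apply_eq W hW hWC (by rw [heq]; exact hΘ)
      rw [Function.comp_apply, hφ', this]
      congr
    · have hmem := (hG.eval_mem_cone ⟨hY, hC⟩ hGY).2
      have hφ' : φ ⟨Projectivization.mk K Y hY, hC⟩ =
          ⟨Projectivization.mk K (fun i => eval Y (G i)) hGY, hmem⟩ :=
        Subtype.ext (hG.apply_eq Y hY hC hGY)
      rw [Function.comp_apply, hφ']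
      exact hH.apply_eq _ hGY hmem hΘ

theorem Represents.cross_mem {φ : C.carrier → C.carrier}
    {G H : Fin (N + 1) → MvPolynomial (Fin (N + 1)) K} (hG : C.Represents φ G)
    (hH : C.Represents φ H) (j l : Fin (N + 1)) : G j * H l - G l * H j ∈ C.ideal := by
  rw [mem_ideal_iff]
  intro X hX
  simp only [map_sub, map_mul]
  by_cases hGX : (fun i => eval X (G i)) = 0
  · rw [show eval X (G j) = 0 from congrFun hGX j, show eval X (G l) = 0 from congrFun hGX l]
    ring
  by_cases hHX : (fun i => eval X (H i)) = 0
  · rw [show eval X (H j) = 0 from congrFun hHX j, show eval X (H l) = 0 from congrFun hHX l]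
    ring
  have h := (hG.apply_eq X hX.1 hX.2 hGX).symm.trans (hH.apply_eq X hX.1 hX.2 hHX)
  obtain ⟨c, hc⟩ := (Projectivization.mk_eq_mk_iff' K _ _ _ _).1 h
  have h1 : ∀ j, eval X (G j) = c * eval X (H j) := fun j => (congrFun hc j).symm
  rw [h1, h1]
  ring

/-- The pull-back fields of two tuples of forms that are proportional on the curve agree. -/
theorem pullbackField_le_of_cross_mem {G H : Fin (N + 1) → MvPolynomial (Fin (N + 1)) K}
    (h : ∀ j l, G j * H l - G l * H j ∈ C.ideal) (hG : ∃ j, G j ∉ C.ideal)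
    (hH : ∃ j, H j ∉ C.ideal) : C.pullbackField G ≤ C.pullbackField H := by
  let π : MvPolynomial (Fin (N + 1)) K →ₐ[K]
      FractionRing (MvPolynomial (Fin (N + 1)) K ⧸ C.ideal) :=
    (IsScalarTower.toAlgHom K (MvPolynomial (Fin (N + 1)) K ⧸ C.ideal) _).comp
      (Ideal.Quotient.mkₐ K C.ideal)
  have hπ : ∀ f, C.toFrac f = π f := fun f => rfl
  obtain ⟨j, hj⟩ := hG
  obtain ⟨l, hl⟩ := hH
  have hl' : π (H l) ≠ 0 := mt (C.toFrac_eq_zero _).1 hl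
  have hj' : π (G j) ≠ 0 := mt (C.toFrac_eq_zero _).1 hj
  set c := π (G l) / π (H l) with hc
  have hGH : ∀ j, π (G j) = c * π (H j) := by
    intro j
    have h1 : C.toFrac (G j * H l - G l * H j) = 0 := (C.toFrac_eq_zero _).2 (h j l)
    rw [hπ, map_sub, map_mul, map_mul, sub_eq_zero] at h1
    rw [hc, div_mul_eq_mul_div, ← h1, mul_div_cancel_right₀ _ hl']
  have hc0 : c ≠ 0 := fun h0 => hj' (by rw [hGH, h0, zero_mul])
  have hF : ∀ {e : ℕ} {F : MvPolynomial (Fin (N + 1)) K}, F.IsHomogeneous e →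
      C.toFrac (bind₁ G F) = c ^ e * C.toFrac (bind₁ H F) := by
    intro e F hF
    have h1 : ∀ G : Fin (N + 1) → MvPolynomial (Fin (N + 1)) K,
        C.toFrac (bind₁ G F) = aeval (fun j => π (G j)) F := fun G => by
      rw [hπ, bind₁, comp_aeval_apply]
    rw [h1, h1, ← aeval_mul_of_isHomogeneous hF]
    simp only [hGH]
  rintro _ ⟨e, F, F', hFe, hFe', hF0, rfl⟩
  refine ⟨e, F, F', hFe, hFe', ?_, ?_⟩
  · rw [← C.toFrac_eq_zero, hF hFe'] at hF0
    rw [← C.toFrac_eq_zero]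
    exact right_ne_zero_of_mul hF0
  · rw [hF hFe, hF hFe', mul_div_mul_left _ _ (pow_ne_zero _ hc0)]

theorem functionField_eq_pullbackField_X :
    C.functionField = C.pullbackField (fun j => MvPolynomial.X j) := by
  rw [functionField, pullbackField]
  congr 1
  exact (algHom_ext fun i => by simp)

theorem pullbackField_bind₁_le {G H : Fin (N + 1) → MvPolynomial (Fin (N + 1)) K}
    (hH : AreForms H) : C.pullbackField (fun j => bind₁ G (H j)) ≤ C.pullbackField G := by
  obtain ⟨m, hm⟩ := hH
  rintro _ ⟨e, F, F', hF, hF', hF0, rfl⟩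
  simp only [← bind₁_bind₁] at hF0 ⊢
  exact ⟨m * e, bind₁ H F, bind₁ H F', hF.aeval H hm, hF'.aeval H hm, hF0, rfl⟩

/-- A map that has a left inverse on the level of representing forms has degree one. -/
theorem HasDegree.eq_one {φ ψ : C.carrier → C.carrier} {d : ℕ} (hd : C.HasDegree φ d)
    {G H : Fin (N + 1) → MvPolynomial (Fin (N + 1)) K} (hG : C.Represents φ G)
    (hH : C.Represents ψ H) {X : Fin (N + 1) → K} (hX : X ∈ C.cone)
    (hGH : (fun j => eval (fun i => eval X (G i)) (H j)) ≠ 0)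
    (hid : ∀ j l, MvPolynomial.X j * bind₁ G (H l) - MvPolynomial.X l * bind₁ G (H j) ∈ C.ideal) :
    d = 1 := by
  obtain ⟨Φ, hΦ, rfl⟩ := hd
  refine Subfield.relfinrank_eq_one_of_le ?_
  rw [functionField_eq_pullbackField_X]
  -- The function field lies in the pull-back field of `H ∘ G`, which lies in that of `G`, hence in
  -- that of `Φ`.
  exact (pullbackField_le_of_cross_mem hid (represents_id hX).nonzero
    (hG.comp hH hX hGH).nonzero).trans ((pullbackField_bind₁_le hH.areForms).trans
      (pullbackField_le_of_cross_mem (hG.cross_mem hΦ) hG.nonzero hΦ.nonzero))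

end Representations

end ProjCurve

/-! ### Norm, units and reduction in the ring of integers. -/

section Integers

variable {p : ℕ} [Fact p.Prime]

theorem PadicComplex.norm_eq_valuation (a : ℂ_[p]) : ‖a‖ = (Valued.v a : NNReal) := by
  rw [PadicComplex.norm_eq_norm, Valued.v.norm_def]
  simp

theorem PadicComplexInt.mem_iff {a : ℂ_[p]} : a ∈ PadicComplexInt p ↔ ‖a‖ ≤ 1 := by
  rw [PadicComplex.norm_eq_valuation, PadicComplexInt, Valuation.mem_valuationSubring_iff]
  norm_cast

theorem PadicComplexInt.norm_le_one (a : PadicComplexInt p) : ‖a‖ ≤ 1 :=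
  PadicComplexInt.mem_iff.1 a.2

theorem PadicComplexInt.isUnit_iff {a : PadicComplexInt p} : IsUnit a ↔ ‖a‖ = 1 := by
  constructor
  · rintro ⟨u, rfl⟩
    have h : ‖(u : PadicComplexInt p)‖ * ‖((u⁻¹ : _ˣ) : PadicComplexInt p)‖ = 1 := by
      rw [← norm_mul, Units.mul_inv, norm_one]
    refine le_antisymm (norm_le_one _) ?_
    rw [← h]
    exact mul_le_of_le_one_right (norm_nonneg _) (norm_le_one _)
  · intro h
    have h0 : (a : ℂ_[p]) ≠ 0 := fun h0 => by
      have : ‖(a : ℂ_[p])‖ = 1 := h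
      rw [h0, norm_zero] at this
      exact zero_ne_one this
    have hinv : (a : ℂ_[p])⁻¹ ∈ PadicComplexInt p := by
      rw [PadicComplexInt.mem_iff, norm_inv]
      have : ‖(a : ℂ_[p])‖ = 1 := h
      rw [this, inv_one]
    exact .of_mul_eq_one ⟨_, hinv⟩ (Subtype.ext (mul_inv_cancel₀ h0))

theorem PadicComplexInt.mem_maximalIdeal_iff {a : PadicComplexInt p} :
    a ∈ IsLocalRing.maximalIdeal (PadicComplexInt p) ↔ ‖a‖ < 1 := by
  rw [IsLocalRing.mem_maximalIdeal, mem_nonunits_iff, PadicComplexInt.isUnit_iff]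
  exact ⟨fun h => lt_of_le_of_ne (norm_le_one a) h, fun h => h.ne⟩

theorem PadicComplexInt.norm_natCast_self : ‖(p : PadicComplexInt p)‖ = (p : ℝ)⁻¹ := by
  have := PadicComplex.norm_extends' p (p : ℚ_[p])
  simpa using this

/-- The vector of complex coordinates of an integral vector. -/
def complexVec {ι : Type*} (z : ι → PadicComplexInt p) : ι → ℂ_[p] := fun j => (z j : ℂ_[p])

theorem eval_complexVec_map {ι : Type*} (z : ι → PadicComplexInt p)
    (P : MvPolynomial ι (PadicComplexInt p)) :
    eval (complexVec z) (MvPolynomial.map (algebraMap (PadicComplexInt p) ℂ_[p]) P) =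
      (eval z P : PadicComplexInt p) := by
  rw [eval_map]
  exact (eval₂_comp (algebraMap (PadicComplexInt p) ℂ_[p]) z P).symm

theorem eval_residue_map {ι : Type*} (z : ι → PadicComplexInt p)
    (P : MvPolynomial ι (PadicComplexInt p)) :
    eval (fun j => IsLocalRing.residue (PadicComplexInt p) (z j))
      (MvPolynomial.map (IsLocalRing.residue (PadicComplexInt p)) P) =
      IsLocalRing.residue (PadicComplexInt p) (eval z P) := by
  rw [eval_map]
  exact (eval₂_comp (IsLocalRing.residue (PadicComplexInt p)) z P).symm

theorem residue_eq_residue_iff {a b : PadicComplexInt p} :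
    IsLocalRing.residue (PadicComplexInt p) a = IsLocalRing.residue (PadicComplexInt p) b ↔
      a - b ∈ IsLocalRing.maximalIdeal (PadicComplexInt p) := by
  rw [← sub_eq_zero, ← map_sub, IsLocalRing.residue_eq_zero_iff]

theorem isUnit_of_sub_mem {a b : PadicComplexInt p}
    (h : a - b ∈ IsLocalRing.maximalIdeal (PadicComplexInt p)) (hb : IsUnit b) : IsUnit a := by
  rw [← IsLocalRing.residue_ne_zero_iff_isUnit] at hb ⊢
  rwa [residue_eq_residue_iff.2 h]

theorem eval_sub_eval_mem {ι : Type*} {z w : ι → PadicComplexInt p}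
    (h : ∀ j, z j - w j ∈ IsLocalRing.maximalIdeal (PadicComplexInt p))
    (P : MvPolynomial ι (PadicComplexInt p)) :
    eval z P - eval w P ∈ IsLocalRing.maximalIdeal (PadicComplexInt p) := by
  rw [← residue_eq_residue_iff, ← eval_residue_map, ← eval_residue_map]
  congr 2
  ext j
  exact residue_eq_residue_iff.2 (h j)

end Integers

/-! ### A residue class as a disc. -/

namespace ProjCurve

section ResidueClass

variable {p : ℕ} [Fact p.Prime] {N : ℕ} (C : ProjCurve ℂ_[p] N)

/-- The points of the curve with the same reduction as `x`, in the chart `T_i = 1`. -/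
def residueClass (i : Fin (N + 1)) (x : Fin (N + 1) → PadicComplexInt p) :
    Set (Fin (N + 1) → PadicComplexInt p) :=
  {z | z i = 1 ∧ (∀ j, z j - x j ∈ IsLocalRing.maximalIdeal (PadicComplexInt p)) ∧
    complexVec z ∈ C.cone}

variable {C}

theorem eval_eq_zero_of_mem_integralIdeal {z : Fin (N + 1) → PadicComplexInt p}
    (hz : complexVec z ∈ C.cone) {F : MvPolynomial (Fin (N + 1)) (PadicComplexInt p)}
    (hF : F ∈ C.integralIdeal) : eval z F = 0 := by
  have h := C.mem_ideal_iff.1 (show _ ∈ C.ideal from hF) _ hz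
  rw [eval_complexVec_map] at h
  exact Subtype.ext h

theorem exists_lift_of_mem_reducedIdeal {f : MvPolynomial (Fin (N + 1)) (PadicComplexResidue p)}
    (hf : f ∈ C.reducedIdeal) : ∃ F ∈ C.integralIdeal,
      MvPolynomial.map (IsLocalRing.residue (PadicComplexInt p)) F = f :=
  (Ideal.mem_map_iff_of_surjective _ (map_surjective _ IsLocalRing.residue_surjective)).1 hf

theorem mk_residue_mem_projZeros {x : Fin (N + 1) → PadicComplexInt p}
    (hx : complexVec x ∈ C.cone)
    (h0 : (fun j => IsLocalRing.residue (PadicComplexInt p) (x j)) ≠ 0) :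
    Projectivization.mk (PadicComplexResidue p) _ h0 ∈ projZeros C.reducedIdeal := by
  intro X hX hXx f hf
  obtain ⟨c, rfl⟩ := (Projectivization.mk_eq_mk_iff' _ _ _ _ _).1 hXx
  obtain ⟨F, hF, rfl⟩ := exists_lift_of_mem_reducedIdeal hf
  obtain ⟨c, rfl⟩ := IsLocalRing.residue_surjective c
  have hc : (c : ℂ_[p]) ≠ 0 := fun hc => hX (by
    have : c = 0 := Subtype.ext hc
    rw [this, map_zero, zero_smul])
  have h1 : complexVec (fun j => c * x j) ∈ C.cone := mul_mem_cone hx hc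
  have h2 : (IsLocalRing.residue (PadicComplexInt p) c •
      fun j => IsLocalRing.residue (PadicComplexInt p) (x j)) =
      fun j => IsLocalRing.residue (PadicComplexInt p) (c * x j) := by
    ext j; simp
  rw [h2, eval_residue_map, eval_eq_zero_of_mem_integralIdeal h1 hF, map_zero]

/-- The functions `P / Q` on a residue class, where `P` and `Q` are polynomials over the ring of
integers and the values of `Q` are units. -/
def residueRing (C : ProjCurve ℂ_[p] N) (i : Fin (N + 1)) (x : Fin (N + 1) → PadicComplexInt p) :
    Subalgebra (PadicComplexInt p) (C.residueClass i x → PadicComplexInt p) where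
  carrier := {f | ∃ P Q : MvPolynomial (Fin (N + 1)) (PadicComplexInt p), ∀ z,
    IsUnit (eval z.1 Q) ∧ f z * eval z.1 Q = eval z.1 P}
  add_mem' := by
    rintro f g ⟨P, Q, h⟩ ⟨P', Q', h'⟩
    refine ⟨P * Q' + P' * Q, Q * Q', fun z => ⟨?_, ?_⟩⟩
    · rw [map_mul]; exact (h z).1.mul (h' z).1
    · simp only [map_mul, map_add, Pi.add_apply, ← (h z).2, ← (h' z).2]; ring
  mul_mem' := by
    rintro f g ⟨P, Q, h⟩ ⟨P', Q', h'⟩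
    refine ⟨P * P', Q * Q', fun z => ⟨?_, ?_⟩⟩
    · rw [map_mul]; exact (h z).1.mul (h' z).1
    · simp only [map_mul, Pi.mul_apply, ← (h z).2, ← (h' z).2]; ring
  algebraMap_mem' := fun c => ⟨MvPolynomial.C c, 1, fun z => by simp⟩

variable {i : Fin (N + 1)} {x : Fin (N + 1) → PadicComplexInt p}

theorem coordinate_mem_residueRing (j : Fin (N + 1)) :
    (fun z => z.1 j) ∈ C.residueRing i x :=
  ⟨X j, 1, fun z => by simp⟩

/-- If `P / Q` has unit values then so does `P`, and `Q / P` is again admissible. Denominators that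
are units pointwise are allowed in the ring for this purpose. -/
theorem exists_inv_mem_residueRing {f : C.residueClass i x → PadicComplexInt p}
    (hf : f ∈ C.residueRing i x) (hu : ∀ z, IsUnit (f z)) :
    ∃ g ∈ C.residueRing i x, ∀ z, f z * g z = 1 := by
  obtain ⟨P, Q, h⟩ := hf
  choose g hg using fun z => (hu z).exists_right_inv
  refine ⟨g, ⟨Q, P, fun z => ⟨?_, ?_⟩⟩, hg⟩
  · rw [← (h z).2]; exact (hu z).mul (h z).1
  · rw [← (h z).2, mul_left_comm, ← mul_assoc, hg, one_mul]

theorem eval_comp_mem_residueRing {u : C.residueClass i x → C.residueClass i x}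
    (hu : ∀ j, (fun z => (u z).1 j) ∈ C.residueRing i x)
    (P : MvPolynomial (Fin (N + 1)) (PadicComplexInt p)) :
    (fun z => eval (u z).1 P) ∈ C.residueRing i x := by
  induction P using MvPolynomial.induction_on with
  | C a => simpa using const_mem (C.residueRing i x) a
  | add P Q hP hQ =>
    simp only [map_add]
    exact Subalgebra.add_mem _ hP hQ
  | mul_X P j hP =>
    simp only [map_mul, eval_X]
    exact Subalgebra.mul_mem _ hP (hu j)

theorem comp_mem_residueRing {u : C.residueClass i x → C.residueClass i x}
    (hu : ∀ j, (fun z => (u z).1 j) ∈ C.residueRing i x)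
    {f : C.residueClass i x → PadicComplexInt p} (hf : f ∈ C.residueRing i x) :
    f ∘ u ∈ C.residueRing i x := by
  obtain ⟨P, Q, h⟩ := hf
  obtain ⟨g, hg, hQg⟩ := exists_inv_mem_residueRing (eval_comp_mem_residueRing hu Q)
    fun z => (h (u z)).1
  have : f ∘ u = (fun z => eval (u z).1 P) * g := by
    ext1 z
    simp only [Function.comp_apply, Pi.mul_apply]
    rw [← (h (u z)).2, mul_assoc, hQg, mul_one]
  rw [this]
  exact Subalgebra.mul_mem _ (eval_comp_mem_residueRing hu P) hg

/-- The functions with values in the maximal ideal. -/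
def residueRingIdeal (C : ProjCurve ℂ_[p] N) (i : Fin (N + 1))
    (x : Fin (N + 1) → PadicComplexInt p) : Ideal (C.residueRing i x) where
  carrier := {f | ∀ z, f.1 z ∈ IsLocalRing.maximalIdeal (PadicComplexInt p)}
  add_mem' := fun hf hg z => Ideal.add_mem _ (hf z) (hg z)
  zero_mem' := fun _ => Ideal.zero_mem _
  smul_mem' := fun _ _ hf z => Ideal.mul_mem_left _ _ (hf z)

theorem residueRingIdeal_le_jacobson : residueRingIdeal C i x ≤ Ideal.jacobson ⊥ := by
  intro f hf
  rw [Ideal.mem_jacobson_bot]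
  intro g
  obtain ⟨k, hk, hfk⟩ := exists_inv_mem_residueRing (f * g + 1).2 (fun z => by
    refine isUnit_of_sub_mem (b := 1) ?_ isUnit_one
    change f.1 z * g.1 z + 1 - 1 ∈ _
    rw [add_sub_cancel_right]
    exact Ideal.mul_mem_right _ _ (hf z))
  exact .of_mul_eq_one ⟨k, hk⟩ (Subtype.ext (funext hfk))

theorem exists_integral_gradient (hC : C.HasGoodReduction) (hxi : x i = 1)
    (hx : complexVec x ∈ C.cone) :
    ∃ j₀, ∃ g : Fin (N + 1) → MvPolynomial (Fin (N + 1)) (PadicComplexInt p),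
      (∀ j, g j ∈ C.integralIdeal) ∧
      ∀ j, j ≠ i → j ≠ j₀ → ∀ l, l ≠ i → l ≠ j₀ → ∀ z ∈ C.residueClass i x,
        eval z (pderiv l (g j)) - (if l = j then 1 else 0) ∈
          IsLocalRing.maximalIdeal (PadicComplexInt p) := by
  set X : Fin (N + 1) → PadicComplexResidue p :=
    fun j => IsLocalRing.residue (PadicComplexInt p) (x j) with hX
  have hXi : X i = 1 := by rw [hX]; simp [hxi]
  have hX0 : X ≠ 0 := fun h => by rw [h] at hXi; exact zero_ne_one hXi
  obtain ⟨j₀, g, hg, hder⟩ := exists_gradient_eq_single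
    (hC X hX0 (mk_residue_mem_projZeros hx hX0) i (by rw [hXi]; exact one_ne_zero))
  simp only [hXi, div_one] at hder
  choose G hG hGg using fun j => exists_lift_of_mem_reducedIdeal (hg j)
  refine ⟨j₀, G, hG, fun j hj hj0 l hl hl0 z hz => ?_⟩
  rw [← residue_eq_residue_iff, ← eval_residue_map, ← pderiv_map, hGg]
  have hzX : (fun j => IsLocalRing.residue (PadicComplexInt p) (z j)) = X :=
    funext fun j => residue_eq_residue_iff.2 (hz.2.1 j)
  rw [hzX]
  refine (hder j hj hj0 l hl hl0).trans ?_
  split_ifs <;> simp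

/-- The coordinate `T_j₀` is a parameter of the residue class of `x`: the difference of the values
of a function at two points is divisible by the difference of the values of `T_j₀`. -/
def IsParameter (C : ProjCurve ℂ_[p] N) (i : Fin (N + 1)) (x : Fin (N + 1) → PadicComplexInt p)
    (j₀ : Fin (N + 1)) : Prop :=
  ∀ u v : C.residueClass i x → C.residueClass i x,
    (∀ j, (fun z => (u z).1 j) ∈ C.residueRing i x) →
    (∀ j, (fun z => (v z).1 j) ∈ C.residueRing i x) →
    ∀ f ∈ C.residueRing i x, ∃ g ∈ C.residueRing i x, ∀ z,
      f (u z) - f (v z) = ((u z).1 j₀ - (v z).1 j₀) * g z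

/-- The Nakayama argument is applied in the ring of functions itself, to two maps `u`, `v` regarded
as solutions of the integral equations. The pair `(id, const a)` later gives division by `t - t(a)`,
and `(F^n, id)` gives division by `t ∘ F^n - t`. -/
theorem exists_parameter (hC : C.HasGoodReduction) (hxi : x i = 1)
    (hx : complexVec x ∈ C.cone) : ∃ j₀, C.IsParameter i x j₀ := by
  obtain ⟨j₀, G, hG, hder⟩ := exists_integral_gradient hC hxi hx
  refine ⟨j₀, fun u v hu hv => ?_⟩
  let U : Fin (N + 1) → C.residueRing i x := fun j => ⟨_, hu j⟩
  let V : Fin (N + 1) → C.residueRing i x := fun j => ⟨_, hv j⟩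
  have hval : ∀ (w : C.residueClass i x → C.residueClass i x)
      (hw : ∀ j, (fun z => (w z).1 j) ∈ C.residueRing i x)
      (P : MvPolynomial (Fin (N + 1)) (PadicComplexInt p)) (z : C.residueClass i x),
      (aeval (fun j => (⟨_, hw j⟩ : C.residueRing i x)) P).1 z = eval (w z).1 P := by
    intro w hw P z
    have h := comp_aeval_apply (fun j => (⟨_, hw j⟩ : C.residueRing i x))
      ((Pi.evalAlgHom (PadicComplexInt p) (fun _ => PadicComplexInt p) z).comp
        (C.residueRing i x).val) P
    rw [← aeval_eq_eval]
    exact h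
  have hspan : ∀ j, U j - V j ∈ Ideal.span {U j₀ - V j₀} := by
    refine sub_mem_span_singleton (A := PadicComplexInt p) (i := i) ?_
      residueRingIdeal_le_jacobson (fun j z => ?_) G (fun j _ _ => ?_) (fun j _ _ => ?_)
      (fun j hj hj0 l hl hl0 z => ?_)
    · exact Subtype.ext (funext fun z => (u z).2.1.trans (v z).2.1.symm)
    · change (u z).1 j - (v z).1 j ∈ _
      rw [← sub_sub_sub_cancel_right _ _ (x j)]
      exact Ideal.sub_mem _ ((u z).2.2.1 j) ((v z).2.2.1 j)
    · refine Subtype.ext (funext fun z => ?_)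
      rw [hval u hu]
      exact eval_eq_zero_of_mem_integralIdeal (u z).2.2.2 (hG j)
    · refine Subtype.ext (funext fun z => ?_)
      rw [hval v hv]
      exact eval_eq_zero_of_mem_integralIdeal (v z).2.2.2 (hG j)
    · have h := hder j hj hj0 l hl hl0 (v z).1 (v z).2
      rw [← hval v hv] at h
      convert h using 1
      change (aeval V (pderiv l (G j))).1 z - (if l = j then (1 : C.residueRing i x) else 0).1 z = _
      split_ifs <;> rfl
  have hpoly : ∀ P : MvPolynomial (Fin (N + 1)) (PadicComplexInt p),
      ∃ g ∈ C.residueRing i x, ∀ z,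
        eval (u z).1 P - eval (v z).1 P = ((u z).1 j₀ - (v z).1 j₀) * g z := by
    intro P
    have h1 : aeval U P - aeval V P ∈ Ideal.span {U j₀ - V j₀} := by
      refine (Ideal.span_le.2 ?_ : Ideal.span (Set.range fun j => U j - V j) ≤ _)
        (aeval_sub_aeval_mem U V P)
      rintro _ ⟨j, rfl⟩
      exact hspan j
    obtain ⟨g, hg⟩ := Ideal.mem_span_singleton'.1 h1
    refine ⟨g.1, g.2, fun z => ?_⟩
    have h2 := congrFun (congrArg Subtype.val hg) z
    rw [← hval u hu, ← hval v hv, mul_comm]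
    exact h2.symm
  rintro f ⟨P, Q, h⟩
  obtain ⟨a, ha, haP⟩ := hpoly P
  obtain ⟨b, hb, hbQ⟩ := hpoly Q
  obtain ⟨c, hc, hcu⟩ := exists_inv_mem_residueRing (eval_comp_mem_residueRing hu Q)
    fun z => (h (u z)).1
  have hfv : f ∘ v ∈ C.residueRing i x := comp_mem_residueRing hv ⟨P, Q, h⟩
  -- Quotient rule: `f(u) - f(v) = (P(u) - P(v) - f(v) (Q(u) - Q(v))) / Q(u)`.
  refine ⟨(a - (f ∘ v) * b) * c, Subalgebra.mul_mem _ (Subalgebra.sub_mem _ ha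
    (Subalgebra.mul_mem _ hfv hb)) hc, fun z => ?_⟩
  simp only [Pi.mul_apply, Pi.sub_apply, Function.comp_apply]
  have e1 := (h (u z)).2
  have e2 := (h (v z)).2
  have e3 := haP z
  have e4 := hbQ z
  have e5 := hcu z
  linear_combination (f (v z) - f (u z)) * e5 + c z * e1 - c z * e2 + c z * e3 - c z * f (v z) * e4

theorem isDiscRing_of_parameter {j₀ : Fin (N + 1)}
    (h : C.IsParameter i x j₀) :
    IsDiscRing (C.residueRing i x) (fun z => z.1 j₀) where
  mem := coordinate_mem_residueRing j₀
  norm_sub_lt z w := by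
    rw [← PadicComplexInt.mem_maximalIdeal_iff, ← sub_sub_sub_cancel_right _ _ (x j₀)]
    exact Ideal.sub_mem _ (z.2.2.1 j₀) (w.2.2.1 j₀)
  injective z w hzw := by
    refine Subtype.ext (funext fun j => ?_)
    obtain ⟨g, -, hg⟩ := h id (fun _ => w) coordinate_mem_residueRing
      (fun j => const_mem _ (w.1 j)) _ (coordinate_mem_residueRing j)
    have h1 := hg z
    simp only [id] at h1
    rw [show z.1 j₀ = w.1 j₀ from hzw, sub_self, zero_mul] at h1
    exact sub_eq_zero.1 h1
  exists_div f hf a := h id (fun _ => a) coordinate_mem_residueRing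
      (fun j => const_mem _ (a.1 j)) f hf

theorem isDiscMap_of_parameter {j₀ : Fin (N + 1)}
    (h : C.IsParameter i x j₀)
    {F : C.residueClass i x → C.residueClass i x}
    (hF : ∀ j, (fun z => (F z).1 j) ∈ C.residueRing i x) :
    IsDiscMap (C.residueRing i x) (fun z => z.1 j₀) F where
  comp f hf := comp_mem_residueRing hF hf
  exists_div f hf n := by
    refine h F^[n] id (fun j => ?_) coordinate_mem_residueRing f hf
    induction n with
    | zero => exact coordinate_mem_residueRing j
    | succ n ih =>
      simp only [Function.iterate_succ]
      exact comp_mem_residueRing hF ih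

end ResidueClass

end ProjCurve

/-! ### Good reduction: iterates on a residue class and their fixed points. -/

namespace ProjCurve

section GoodReduction

variable {p : ℕ} [Fact p.Prime] {N : ℕ} {C : ProjCurve ℂ_[p] N}

/-- The base change of a polynomial over the ring of integers to the field. -/
noncomputable abbrev complexPoly (P : MvPolynomial (Fin (N + 1)) (PadicComplexInt p)) :
    MvPolynomial (Fin (N + 1)) ℂ_[p] :=
  MvPolynomial.map (algebraMap (PadicComplexInt p) ℂ_[p]) P

theorem complexVec_ne_zero {z : Fin (N + 1) → PadicComplexInt p} (h : ∃ j, IsUnit (z j)) :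
    complexVec z ≠ 0 := by
  rintro h0
  obtain ⟨j, hj⟩ := h
  have : z j = 0 := Subtype.ext (congrFun h0 j)
  rw [this] at hj
  exact not_isUnit_zero hj

theorem eval_complexVec_complexPoly (z : Fin (N + 1) → PadicComplexInt p)
    (G : Fin (N + 1) → MvPolynomial (Fin (N + 1)) (PadicComplexInt p)) :
    (fun j => eval (complexVec z) (complexPoly (G j))) = complexVec (fun j => eval z (G j)) := by
  funext j
  exact eval_complexVec_map z (G j)

theorem MapHasGoodReduction.exists_represents {φ : C.carrier → C.carrier}
    (hφ : C.MapHasGoodReduction φ) {x : Fin (N + 1) → PadicComplexInt p}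
    (hx : complexVec x ∈ C.cone) (hxu : ∃ j, IsUnit (x j)) :
    ∃ G : Fin (N + 1) → MvPolynomial (Fin (N + 1)) (PadicComplexInt p),
      C.Represents φ (fun j => complexPoly (G j)) ∧ ∃ j, IsUnit (eval x (G j)) := by
  have h0 : (fun j => IsLocalRing.residue (PadicComplexInt p) (x j)) ≠ 0 := fun h => by
    obtain ⟨j, hj⟩ := hxu
    exact (IsLocalRing.residue_ne_zero_iff_isUnit _).2 hj (congrFun h j)
  obtain ⟨G, hG, hG0⟩ := hφ _ h0 (mk_residue_mem_projZeros hx h0)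
  refine ⟨G, hG, ?_⟩
  by_contra! h
  refine hG0 (funext fun j => ?_)
  rw [eval_residue_map]
  exact (IsLocalRing.residue_eq_zero_iff _).2 ((IsLocalRing.mem_maximalIdeal _).2 (h j))

/-- The image vector is again integral with a unit coordinate, so good reduction can be used anew at
the image without rescaling. -/
theorem MapHasGoodReduction.exists_represents_iterate {φ : C.carrier → C.carrier}
    (hφ : C.MapHasGoodReduction φ) (n : ℕ) {x : Fin (N + 1) → PadicComplexInt p}
    (hx : complexVec x ∈ C.cone) (hxu : ∃ j, IsUnit (x j)) :
    ∃ G : Fin (N + 1) → MvPolynomial (Fin (N + 1)) (PadicComplexInt p),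
      C.Represents φ^[n] (fun j => complexPoly (G j)) ∧ ∃ j, IsUnit (eval x (G j)) := by
  induction n generalizing x with
  | zero => exact ⟨X, by simpa using represents_id hx, by simpa using hxu⟩
  | succ n ih =>
    obtain ⟨G, hG, hGu⟩ := hφ.exists_represents hx hxu
    have hGx := eval_complexVec_complexPoly x G
    have hx' : complexVec (fun j => eval x (G j)) ∈ C.cone := by
      rw [← hGx]
      exact hG.eval_mem_cone hx (by rw [hGx]; exact complexVec_ne_zero hGu)
    obtain ⟨H, hH, hHu⟩ := ih hx' hGu
    refine ⟨fun j => bind₁ G (H j), ?_, by simpa only [eval_bind₁] using hHu⟩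
    rw [Function.iterate_succ]
    simp only [complexPoly, map_bind₁]
    refine hG.comp hH hx ?_
    rw [hGx, eval_complexVec_complexPoly]
    exact complexVec_ne_zero hHu

variable {i : Fin (N + 1)} {x : Fin (N + 1) → PadicComplexInt p}

/-- The point of the curve with given coordinates. -/
noncomputable def residueClassPoint (z : C.residueClass i x) : C.carrier :=
  ⟨Projectivization.mk _ _ z.2.2.2.1, z.2.2.2.2⟩

theorem residueClassPoint_eq_iff {z : C.residueClass i x} {y : C.carrier}
    {Y : Fin (N + 1) → ℂ_[p]} {hY : Y ≠ 0} (hy : y.1 = Projectivization.mk _ Y hY) :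
    residueClassPoint z = y ↔ ∀ j, Y j = Y i * z.1 j := by
  rw [← Subtype.coe_inj, hy]
  refine (Projectivization.mk_eq_mk_iff' _ _ _ _ _).trans ⟨?_, fun h => ?_⟩
  · rintro ⟨a, ha⟩ j
    have h1 : a * Y i = 1 := by
      have := congrFun ha i
      rw [complexVec, z.2.1] at this
      exact this
    have h2 : a * Y j = z.1 j := congrFun ha j
    linear_combination (-Y j) * h1 + Y i * h2
  · have hYi : Y i ≠ 0 := fun h0 => hY (funext fun j => by rw [h, h0, zero_mul]; rfl)
    refine ⟨(Y i)⁻¹, funext fun j => ?_⟩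
    rw [Pi.smul_apply, smul_eq_mul, h j, inv_mul_cancel_left₀ hYi]
    rfl

theorem residueClassPoint_injective :
    Function.Injective (residueClassPoint : C.residueClass i x → C.carrier) := by
  intro z w hzw
  have h := (residueClassPoint_eq_iff (z := z) (y := residueClassPoint w) rfl).1 hzw
  refine Subtype.ext (funext fun j => ?_)
  have h2 := h j
  simp only [complexVec, w.2.1] at h2
  exact Subtype.ext (by simpa using h2.symm)

/-- A power of `φ` with a fixed point in a residue class maps the class to itself. -/
theorem exists_self_map {φ : C.carrier → C.carrier}
    (hφ : C.MapHasGoodReduction φ) {M : ℕ} {y₀ : C.residueClass i x}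
    (hy₀ : φ^[M] (residueClassPoint y₀) = residueClassPoint y₀) :
    ∃ F : C.residueClass i x → C.residueClass i x,
      (∀ z, residueClassPoint (F z) = φ^[M] (residueClassPoint z)) ∧
      ∀ j, (fun z => (F z).1 j) ∈ C.residueRing i x := by
  have hy₀u : ∃ j, IsUnit (y₀.1 j) := ⟨i, by rw [y₀.2.1]; exact isUnit_one⟩
  obtain ⟨G, hG, hGu⟩ := hφ.exists_represents_iterate M y₀.2.2.2 hy₀u
  have hsub : ∀ (z : C.residueClass i x) P, eval z.1 P - eval y₀.1 P ∈
      IsLocalRing.maximalIdeal (PadicComplexInt p) := fun z P => by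
    refine eval_sub_eval_mem (fun j => ?_) P
    rw [← sub_sub_sub_cancel_right _ _ (x j)]
    exact Ideal.sub_mem _ (z.2.2.1 j) (y₀.2.2.1 j)
  have hGz : ∀ z : C.residueClass i x, ∃ j, IsUnit (eval z.1 (G j)) := fun z =>
    hGu.imp fun j hj => isUnit_of_sub_mem (hsub z _) hj
  have hne : ∀ z : C.residueClass i x,
      (fun j => eval (complexVec z.1) (complexPoly (G j))) ≠ 0 := fun z => by
    rw [eval_complexVec_complexPoly]; exact complexVec_ne_zero (hGz z)
  have hmap : ∀ z : C.residueClass i x, (φ^[M] (residueClassPoint z)).1 =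
      Projectivization.mk _ _ (hne z) := fun z =>
    hG.apply_eq _ z.2.2.2.1 z.2.2.2.2 (hne z)
  -- At the fixed point the values `G j` are `G i` times the coordinates, so the unit among them
  -- forces `G i` to be a unit there. By congruence it is a unit on the whole class, and `F` is
  -- obtained by dividing by it.
  have hfix : ∀ j, eval y₀.1 (G j) = eval y₀.1 (G i) * y₀.1 j := fun j => by
    have h := (residueClassPoint_eq_iff (hmap y₀)).1 hy₀.symm j
    rw [eval_complexVec_map, eval_complexVec_map] at h
    exact Subtype.ext h
  have hGi : ∀ z : C.residueClass i x, IsUnit (eval z.1 (G i)) := fun z => by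
    refine isUnit_of_sub_mem (hsub z _) ?_
    obtain ⟨j, hj⟩ := hGu
    rw [hfix] at hj
    exact isUnit_of_mul_isUnit_left hj
  have hGmem : ∀ j, (fun z : C.residueClass i x => eval z.1 (G j)) ∈ C.residueRing i x :=
    fun j => eval_comp_mem_residueRing (u := id) coordinate_mem_residueRing (G j)
  obtain ⟨c, hc, hcG⟩ := exists_inv_mem_residueRing (hGmem i) hGi
  have hcu : ∀ z, IsUnit (c z) := fun z => .of_mul_eq_one_right _ (hcG z)
  have hFmem : ∀ z, (fun j => c z * eval z.1 (G j)) ∈ C.residueClass i x := by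
    intro z
    refine ⟨(mul_comm _ _).trans (hcG z), fun j => ?_, ?_⟩
    · have h1 := hsub z (G j)
      have h2 := hsub z (G i)
      have h3 := y₀.2.2.1 j
      have h4 : c z * eval z.1 (G j) - x j = c z * (eval z.1 (G j) - eval y₀.1 (G j)) -
          c z * y₀.1 j * (eval z.1 (G i) - eval y₀.1 (G i)) + (y₀.1 j - x j) := by
        have := hcG z
        linear_combination c z * hfix j + y₀.1 j * this
      rw [h4]
      exact Ideal.add_mem _ (Ideal.sub_mem _ (Ideal.mul_mem_left _ _ h1)
        (Ideal.mul_mem_left _ _ h2)) h3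
    · have h1 := hG.eval_mem_cone z.2.2.2 (hne z)
      rw [eval_complexVec_complexPoly] at h1
      exact mul_mem_cone h1 (c := (c z : ℂ_[p])) fun h0 => by
        have : c z = 0 := Subtype.ext h0
        have h2 := hcu z
        rw [this] at h2
        exact not_isUnit_zero h2
  refine ⟨fun z => ⟨_, hFmem z⟩, fun z => ?_, fun j => Subalgebra.mul_mem _ hc (hGmem j)⟩
  rw [residueClassPoint_eq_iff (hmap z)]
  intro j
  rw [eval_complexVec_map, eval_complexVec_map]
  have := congrArg (Subtype.val) (hcG z)
  change ((eval z.1 (G i) : PadicComplexInt p) : ℂ_[p]) * (c z : ℂ_[p]) = 1 at this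
  change _ = _ * ((c z : ℂ_[p]) * ((eval z.1 (G j) : PadicComplexInt p) : ℂ_[p]))
  rw [← mul_assoc, this, one_mul]

/-- The fixed points of an iterate of a map of degree greater than one do not accumulate. -/
theorem exists_forall_le_norm_of_iterate_eq (hsmooth : C.IsSmooth) {φ : C.carrier → C.carrier}
    (hφ : C.MapHasGoodReduction φ) {d : ℕ} (hdeg : C.HasDegree φ d) (hd : 1 < d)
    (hxC : complexVec x ∈ C.cone) (hxi : x i = 1) {j₀ : Fin (N + 1)}
    (hj₀ : C.IsParameter i x j₀) {n : ℕ} (hn : 0 < n) :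
    ∃ ρ > 0, ∀ y : C.residueClass i x, y.1 ≠ x →
      φ^[n] (residueClassPoint y) = residueClassPoint y → ρ ≤ ‖y.1 j₀ - x j₀‖ := by
  have hxu : ∃ j, IsUnit (x j) := ⟨i, by rw [hxi]; exact isUnit_one⟩
  -- Splitting off one factor `φ`: if the iterate were the identity, the remaining power would be a
  -- left inverse of `φ`, forcing degree 1.
  obtain ⟨n, rfl⟩ : ∃ m, n = m + 1 := ⟨n - 1, by omega⟩
  obtain ⟨G, hG, hGu⟩ := hφ.exists_represents hxC hxu
  have hGx := eval_complexVec_complexPoly x G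
  have hx' : complexVec (fun j => eval x (G j)) ∈ C.cone := by
    rw [← hGx]
    exact hG.eval_mem_cone hxC (by rw [hGx]; exact complexVec_ne_zero hGu)
  obtain ⟨H, hH, hHu⟩ := hφ.exists_represents_iterate n hx' hGu
  have hGH : (fun j => eval (fun i => eval (complexVec x) (complexPoly (G i)))
      (complexPoly (H j))) ≠ 0 := by
    rw [hGx, eval_complexVec_complexPoly]
    exact complexVec_ne_zero hHu
  have hcomp := hG.comp hH hxC hGH
  rw [← Function.iterate_succ] at hcomp
  simp only [complexPoly, ← map_bind₁] at hcomp
  set Θ := fun j => bind₁ G (H j) with hΘ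
  have hΘx : ∃ j, IsUnit (eval x (Θ j)) := by simpa only [hΘ, eval_bind₁] using hHu
  -- This form vanishes at all fixed points of the iterate, but not on all of `C`.
  obtain ⟨j, l, hjl⟩ : ∃ j l, X j * complexPoly (Θ l) - X l * complexPoly (Θ j) ∉ C.ideal := by
    by_contra! hall
    refine hd.ne' (hdeg.eq_one hG hH hxC hGH fun j l => ?_)
    have := hall j l
    simpa only [hΘ, complexPoly, map_bind₁] using this
  obtain ⟨e, he⟩ := hcomp.areForms
  have hhom : (X j * complexPoly (Θ l) - X l * complexPoly (Θ j)).IsHomogeneous (1 + e) :=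
    ((isHomogeneous_X _ j).mul (he l)).sub ((isHomogeneous_X _ l).mul (he j))
  obtain ⟨ε, hε, hεz⟩ := exists_forall_eq_of_eval_eq_zero hsmooth (i := i) (x := complexVec x)
    ⟨by rw [complexVec, hxi]; rfl, hxC⟩ hhom hjl
  refine ⟨ε, hε, fun y hyx hy => not_lt.1 fun hlt => hyx ?_⟩
  have hxmem : x ∈ C.residueClass i x := ⟨hxi, fun j => by simp, hxC⟩
  have hΘy : ∃ j, IsUnit (eval y.1 (Θ j)) := hΘx.imp fun j hj =>
    isUnit_of_sub_mem (eval_sub_eval_mem y.2.2.1 _) hj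
  have hne : (fun j => eval (complexVec y.1) (complexPoly (Θ j))) ≠ 0 := by
    rw [eval_complexVec_complexPoly]; exact complexVec_ne_zero hΘy
  have hrel := (residueClassPoint_eq_iff (z := y)
    (hcomp.apply_eq _ y.2.2.2.1 y.2.2.2.2 hne)).1 hy.symm
  have heq := hεz (complexVec y.1) ⟨by rw [complexVec, y.2.1]; rfl, y.2.2.2⟩ (fun k => ?_) ?_
  · exact funext fun k => Subtype.ext (congrFun heq k)
  -- The parameter controls every coordinate: `|y_k - x_k| ≤ |y_{j₀} - x_{j₀}|`.
  · obtain ⟨g, -, hg⟩ := hj₀ id (fun _ => ⟨x, hxmem⟩) coordinate_mem_residueRing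
      (fun j => const_mem _ (x j)) _ (coordinate_mem_residueRing k)
    have h1 := hg y
    change y.1 k - x k = _ at h1
    have h2 : ‖y.1 k - x k‖ < ε := by
      rw [h1, norm_mul]
      exact (mul_le_of_le_one_right (norm_nonneg _) (PadicComplexInt.norm_le_one _)).trans_lt hlt
    exact h2
  · rw [map_sub, map_mul, map_mul, eval_X, eval_X, hrel l, hrel j]
    simp only [complexVec]
    ring

end GoodReduction

end ProjCurve

/-! ### The chordal metric and the final estimate. -/

section Chordal

variable {p : ℕ} [Fact p.Prime] {N : ℕ}

theorem chordalDist_mk {X Y : Fin (N + 1) → ℂ_[p]} (hX : X ≠ 0) (hY : Y ≠ 0) :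
    chordalDist (Projectivization.mk _ X hX) (Projectivization.mk _ Y hY) =
      ‖fun ij : Fin (N + 1) × Fin (N + 1) => X ij.1 * Y ij.2 - X ij.2 * Y ij.1‖ /
        (‖X‖ * ‖Y‖) := by
  obtain ⟨a, ha⟩ := Projectivization.exists_smul_eq_mk_rep ℂ_[p] X hX
  obtain ⟨b, hb⟩ := Projectivization.exists_smul_eq_mk_rep ℂ_[p] Y hY
  have ha0 : ‖(a : ℂ_[p])‖ ≠ 0 := norm_ne_zero_iff.2 a.ne_zero
  have hb0 : ‖(b : ℂ_[p])‖ ≠ 0 := norm_ne_zero_iff.2 b.ne_zero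
  rw [chordalDist, ← ha, ← hb]
  have h : (fun ij : Fin (N + 1) × Fin (N + 1) =>
      (a • X) ij.1 * (b • Y) ij.2 - (a • X) ij.2 * (b • Y) ij.1) =
      ((a : ℂ_[p]) * b) • fun ij : Fin (N + 1) × Fin (N + 1) =>
        X ij.1 * Y ij.2 - X ij.2 * Y ij.1 := by
    ext ij
    simp only [Pi.smul_apply, Units.smul_def, smul_eq_mul]
    ring
  rw [h, norm_smul, Units.smul_def, Units.smul_def, norm_smul, norm_smul, norm_mul,
    show ‖(a : ℂ_[p])‖ * ‖X‖ * (‖(b : ℂ_[p])‖ * ‖Y‖) =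
      ‖(a : ℂ_[p])‖ * ‖(b : ℂ_[p])‖ * (‖X‖ * ‖Y‖) by ring,
    mul_div_mul_left _ _ (mul_ne_zero ha0 hb0)]

theorem exists_integral_coordinates (x : Projectivization ℂ_[p] (Fin (N + 1) → ℂ_[p])) :
    ∃ (i : Fin (N + 1)) (z : Fin (N + 1) → PadicComplexInt p) (hz : complexVec z ≠ 0), z i = 1 ∧
      x = Projectivization.mk _ (complexVec z) hz := by
  obtain ⟨i, hi⟩ := Finite.exists_max fun j => ‖x.rep j‖
  have hi0 : x.rep i ≠ 0 := fun h0 => x.rep_nonzero (funext fun j => by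
    have := hi j
    rw [h0, norm_zero] at this
    exact norm_le_zero_iff.1 this)
  have hint : ∀ j, (x.rep i)⁻¹ * x.rep j ∈ PadicComplexInt p := fun j => by
    rw [PadicComplexInt.mem_iff, norm_mul, norm_inv, inv_mul_le_one₀ (norm_pos_iff.2 hi0)]
    exact hi j
  let z : Fin (N + 1) → PadicComplexInt p := fun j => ⟨_, hint j⟩
  have hzi : z i = 1 := Subtype.ext (inv_mul_cancel₀ hi0)
  have hz : complexVec z ≠ 0 :=
    ProjCurve.complexVec_ne_zero ⟨i, by rw [hzi]; exact isUnit_one⟩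
  refine ⟨i, z, hz, hzi, ?_⟩
  rw [← x.mk_rep]
  refine (Projectivization.mk_eq_mk_iff' _ _ _ _ _).2 ⟨x.rep i, funext fun j => ?_⟩
  exact mul_inv_cancel_left₀ hi0 _

/-- Integral vectors have norm at most 1, so dividing by their norms can only enlarge the minors. -/
theorem norm_le_chordalDist {x y : Fin (N + 1) → PadicComplexInt p} (hx : complexVec x ≠ 0)
    (hy : complexVec y ≠ 0) (j l : Fin (N + 1)) :
    ‖x j * y l - x l * y j‖ ≤
      chordalDist (Projectivization.mk _ _ hx) (Projectivization.mk _ _ hy) := by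
  have hle : ∀ z : Fin (N + 1) → PadicComplexInt p, ‖complexVec z‖ ≤ 1 := fun z =>
    (pi_norm_le_iff_of_nonneg zero_le_one).2 fun j => PadicComplexInt.norm_le_one (z j)
  rw [chordalDist_mk, le_div_iff₀ (mul_pos (norm_pos_iff.2 hx) (norm_pos_iff.2 hy))]
  refine (mul_le_of_le_one_right (norm_nonneg _)
    (mul_le_one₀ (hle x) (norm_nonneg _) (hle y))).trans ?_
  exact norm_le_pi_norm (fun ij : Fin (N + 1) × Fin (N + 1) =>
    complexVec x ij.1 * complexVec y ij.2 - complexVec x ij.2 * complexVec y ij.1) (j, l)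

namespace ProjCurve

variable {C : ProjCurve ℂ_[p] N} {i : Fin (N + 1)} {x : Fin (N + 1) → PadicComplexInt p}

/-- Points at chordal distance less than one have the same reduction. -/
theorem exists_residueClassPoint_eq (hx : complexVec x ≠ 0) (hxi : x i = 1) {y : C.carrier}
    (h : chordalDist (Projectivization.mk _ _ hx) y.1 < 1) :
    ∃ z : C.residueClass i x, residueClassPoint z = y := by
  obtain ⟨l, w, hw, hwl, hy⟩ := exists_integral_coordinates y.1
  rw [hy] at h
  have h1 : ∀ j, ‖w j - x j * w i‖ < 1 := fun j => by
    have h2 := (norm_le_chordalDist hx hw i j).trans_lt h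
    rwa [hxi, one_mul] at h2
  -- For the coordinate with `w l = 1` the estimate reads `|1 - x l * w i| < 1`, which makes `w i` a
  -- unit.
  have hwi : IsUnit (w i) := by
    have h2 := h1 l
    rw [hwl, norm_sub_rev] at h2
    exact isUnit_of_mul_isUnit_right
      (isUnit_of_sub_mem (PadicComplexInt.mem_maximalIdeal_iff.2 h2) isUnit_one)
  obtain ⟨c, hc⟩ := hwi.exists_right_inv
  have hc0 : (c : ℂ_[p]) ≠ 0 := fun h0 => by
    have : c = 0 := Subtype.ext h0
    rw [this, mul_zero] at hc
    exact zero_ne_one hc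
  have hwC : complexVec w ∈ C.cone := ⟨hw, hy ▸ y.2⟩
  have hz : (fun j => c * w j) ∈ C.residueClass i x := by
    refine ⟨(mul_comm _ _).trans hc, fun j => ?_, mul_mem_cone hwC hc0⟩
    have h2 : c * w j - x j = c * (w j - x j * w i) := by linear_combination x j * hc
    rw [h2]
    exact Ideal.mul_mem_left _ _ (PadicComplexInt.mem_maximalIdeal_iff.2 (h1 j))
  refine ⟨⟨_, hz⟩, (residueClassPoint_eq_iff hy).2 fun j => ?_⟩
  have h2 : (w i : ℂ_[p]) * c = 1 := congrArg Subtype.val hc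
  change (w j : ℂ_[p]) = w i * (c * w j)
  rw [← mul_assoc, h2, one_mul]

theorem norm_sub_le_chordalDist (hx : complexVec x ≠ 0) (hxi : x i = 1)
    (z : C.residueClass i x) (j : Fin (N + 1)) :
    ‖z.1 j - x j‖ ≤ chordalDist (Projectivization.mk _ _ hx) (residueClassPoint z).1 := by
  have h : z.1 j - x j = x i * z.1 j - x j * z.1 i := by rw [hxi, z.2.1, one_mul, mul_one]
  rw [h]
  exact norm_le_chordalDist hx z.2.2.2.1 i j

/-- On the class `F^[R]` is conjugate to `φ^[M * R]`, and a period `n` drops to `n / gcd(n, M R)`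
under that iterate. -/
theorem minimalPeriod_residueClass {φ : C.carrier → C.carrier} {M R : ℕ} (hMR : M * R ≠ 0)
    {F : C.residueClass i x → C.residueClass i x}
    (hF : ∀ z, residueClassPoint (F z) = φ^[M] (residueClassPoint z)) (z : C.residueClass i x) :
    Function.minimalPeriod F^[R] z = Function.minimalPeriod φ (residueClassPoint z) /
      (Function.minimalPeriod φ (residueClassPoint z)).gcd (M * R) := by
  rw [← Function.minimalPeriod_iterate_eq_div_gcd hMR,
    Function.minimalPeriod_eq_minimalPeriod_iff]
  intro n
  have hsemi : Function.Semiconj residueClassPoint F φ^[M] := hF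
  rw [Function.IsPeriodicPt, Function.IsPeriodicPt, Function.IsFixedPt, Function.IsFixedPt,
    Function.iterate_mul]
  have h := ((hsemi.iterate_right R).iterate_right n).eq z
  rw [← h]
  exact residueClassPoint_injective.eq_iff.symm

/-- The periodic points of large period stay away from `x`, in terms of powers of the distance. -/
theorem exists_forall_le_norm_pow (hsmooth : C.IsSmooth) {φ : C.carrier → C.carrier}
    (hφ : C.MapHasGoodReduction φ) {d : ℕ} (hdeg : C.HasDegree φ d) (hd : 1 < d)
    (hxC : complexVec x ∈ C.cone) (hxi : x i = 1) {j₀ : Fin (N + 1)}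
    (hj₀ : C.IsParameter i x j₀) :
    ∃ κ : ℝ, 0 < κ ∧ ∀ y : C.residueClass i x, y.1 ≠ x →
      0 < Function.minimalPeriod φ (residueClassPoint y) →
      κ ≤ ‖y.1 j₀ - x j₀‖ ^ Function.minimalPeriod φ (residueClassPoint y) := by
  by_cases hex : ∃ y₀ : C.residueClass i x, 0 < Function.minimalPeriod φ (residueClassPoint y₀)
  swap
  · exact ⟨1, one_pos, fun y _ hy => (hex ⟨y, hy⟩).elim⟩
  obtain ⟨y₀, hM⟩ := hex
  set M := Function.minimalPeriod φ (residueClassPoint y₀)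
  have hy₀ : φ^[M] (residueClassPoint y₀) = residueClassPoint y₀ :=
    Function.iterate_minimalPeriod
  obtain ⟨F, hF, hFS⟩ := exists_self_map hφ hy₀
  have hFy₀ : F y₀ = y₀ := residueClassPoint_injective (by rw [hF, hy₀])
  have hp : p.Prime := Fact.out
  have hpn : ‖(p : PadicComplexInt p)‖ = (p : ℝ)⁻¹ := PadicComplexInt.norm_natCast_self
  have hp1 : ‖(p : PadicComplexInt p)‖ < 1 := by
    rw [hpn]; exact inv_lt_one_of_one_lt₀ (by exact_mod_cast hp.one_lt)
  have hp0 : 0 < ‖(p : PadicComplexInt p)‖ := by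
    rw [hpn]; exact inv_pos.2 (by exact_mod_cast hp.pos)
  obtain ⟨R, k₀, hR, hk₀⟩ := exists_forall_norm_le_pow_minimalPeriod
    (isDiscRing_of_parameter hj₀) (isDiscMap_of_parameter hj₀ hFS) PadicComplexInt.norm_le_one
    hp hp1 (norm_pos_iff.1 hp0) hFy₀
  have hMR : 0 < M * R := Nat.mul_pos hM hR
  have hy₀x : ‖y₀.1 j₀ - x j₀‖ < 1 := PadicComplexInt.mem_maximalIdeal_iff.1 (y₀.2.2.1 j₀)
  -- Beyond `k₁` the bound `|p| ≤ |y - y₀|^k` forces `y` to be farther from `y₀` than `x` is.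
  obtain ⟨k₁, hk₁⟩ := exists_pow_lt_of_lt_one hp0 hy₀x
  set K := max k₀ k₁ with hK
  -- With `k` the period under `F^[R]`, the period `n` divides `M R k`. So every point with `k ≤ K`
  -- is fixed by the single iterate of order `M R K!`.
  obtain ⟨ρ, hρ, hρy⟩ := exists_forall_le_norm_of_iterate_eq hsmooth hφ hdeg hd hxC hxi hj₀
    (n := M * R * K.factorial) (Nat.mul_pos hMR K.factorial_pos)
  refine ⟨min (‖(p : PadicComplexInt p)‖ ^ (M * R)) (min ρ 1 ^ (M * R * K)),
    lt_min (pow_pos hp0 _) (pow_pos (lt_min hρ one_pos) _), fun y hyx hn => ?_⟩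
  set n := Function.minimalPeriod φ (residueClassPoint y) with hn_def
  have hk := minimalPeriod_residueClass hMR.ne' hF y
  rw [← hn_def] at hk
  set k := Function.minimalPeriod F^[R] y
  have hgcd : n.gcd (M * R) * k = n := by rw [hk]; exact Nat.mul_div_cancel' (Nat.gcd_dvd_left _ _)
  have hnk : n ≤ M * R * k := by
    conv_lhs => rw [← hgcd]
    exact Nat.mul_le_mul_right _ (Nat.le_of_dvd hMR (Nat.gcd_dvd_right _ _))
  have hk0 : 0 < k := Nat.pos_of_ne_zero fun h => by rw [h, mul_zero] at hgcd; omega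
  have hδ1 : ‖y.1 j₀ - x j₀‖ ≤ 1 := PadicComplexInt.norm_le_one _
  by_cases hkK : k ≤ K
  · refine (min_le_right _ _).trans ?_
    have hper : φ^[M * R * K.factorial] (residueClassPoint y) = residueClassPoint y := by
      have hdvd : n ∣ M * R * K.factorial := by
        rw [← hgcd]
        exact Nat.mul_dvd_mul (Nat.gcd_dvd_right _ _) (Nat.dvd_factorial hk0 hkK)
      exact Function.isPeriodicPt_iff_minimalPeriod_dvd.2 hdvd
    have h1 := hρy y hyx hper
    have hmin : (0 : ℝ) ≤ min ρ 1 := le_min hρ.le zero_le_one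
    calc min ρ 1 ^ (M * R * K) ≤ min ρ 1 ^ n :=
          pow_le_pow_of_le_one hmin (min_le_right _ _)
            (hnk.trans (Nat.mul_le_mul_left _ hkK))
      _ ≤ _ := pow_le_pow_left₀ hmin ((min_le_left _ _).trans h1) _
  · refine (min_le_left _ _).trans ?_
    push Not at hkK
    have h1 := hk₀ y ((le_max_left _ _).trans_lt hkK)
    have h2 : ‖y₀.1 j₀ - x j₀‖ < ‖y.1 j₀ - y₀.1 j₀‖ := by
      by_contra! h
      refine (hk₁.trans_le' ?_).not_ge le_rfl
      refine h1.trans ((pow_le_pow_left₀ (norm_nonneg _) h _).trans ?_)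
      exact pow_le_pow_of_le_one (norm_nonneg _) hy₀x.le ((le_max_right _ _).trans hkK.le)
    -- The ultrametric triangle is isosceles: `x` is closer to `y₀` than `y` is.
    have h3 : ‖y.1 j₀ - x j₀‖ = ‖y.1 j₀ - y₀.1 j₀‖ := by
      refine norm_eq_of_norm_sub_lt ?_
      rwa [sub_sub_sub_cancel_left]
    calc ‖(p : PadicComplexInt p)‖ ^ (M * R) ≤ (‖y.1 j₀ - x j₀‖ ^ k) ^ (M * R) := by
          rw [h3]; exact pow_le_pow_left₀ hp0.le h1 _
      _ = ‖y.1 j₀ - x j₀‖ ^ (M * R * k) := by rw [← pow_mul, mul_comm]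
      _ ≤ _ := pow_le_pow_of_le_one (norm_nonneg _) hδ1 hnk

end ProjCurve

theorem rpow_one_div_le_of_le_pow {a b : ℝ} (ha : 0 ≤ a) (hb : 0 ≤ b) {n : ℕ} (hn : n ≠ 0)
    (h : a ≤ b ^ n) : a ^ (1 / (n : ℝ)) ≤ b := by
  rw [one_div]
  exact (Real.rpow_le_rpow ha h (by positivity)).trans_eq (Real.pow_rpow_inv_natCast hb hn)

end Chordal

theorem theorem1 (p : ℕ) [Fact p.Prime] (N : ℕ) (C : ProjCurve ℂ_[p] N)
    (hsmooth : C.IsSmooth) (hgood : C.HasGoodReduction)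
    (φ : C.carrier → C.carrier) (hmor : C.IsMorphism φ) (hφ : C.MapHasGoodReduction φ)
    (d : ℕ) (hdeg : C.HasDegree φ d) (hd : 1 < d) (x : C.carrier) :
    ∃ κ : ℝ, 0 < κ ∧ ∀ (n : ℕ) (y : C.carrier), 0 < n → Function.minimalPeriod φ y = n → y ≠ x →
      (κ * ‖(n : ℂ_[p])‖) ^ (1 / (n : ℝ)) ≤ chordalDist x.1 y.1 := by
  obtain ⟨i, w, hw, hwi, hx⟩ := exists_integral_coordinates x.1
  have hwC : complexVec w ∈ C.cone := ⟨hw, hx ▸ x.2⟩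
  obtain ⟨j₀, hj₀⟩ := ProjCurve.exists_parameter hgood hwi hwC
  obtain ⟨κ, hκ, h⟩ :=
    ProjCurve.exists_forall_le_norm_pow hsmooth hφ hdeg hd hwC hwi hj₀
  -- `κ` serves the points with the same reduction as `x`, and 1 serves the points at chordal
  -- distance at least 1. The factor `|n| ≤ 1` is simply discarded.
  refine ⟨min κ 1, lt_min hκ one_pos, fun n y hn hyn hyx => ?_⟩
  have hn1 : ‖(n : ℂ_[p])‖ ≤ 1 := PadicComplexInt.norm_le_one (n : PadicComplexInt p)
  have hmin : 0 ≤ min κ 1 := (lt_min hκ one_pos).le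
  have h0 : 0 ≤ min κ 1 * ‖(n : ℂ_[p])‖ := mul_nonneg hmin (norm_nonneg _)
  have h1 : min κ 1 * ‖(n : ℂ_[p])‖ ≤ min κ 1 := mul_le_of_le_one_right hmin hn1
  by_cases hlt : chordalDist x.1 y.1 < 1
  · rw [hx] at hlt ⊢
    obtain ⟨z, rfl⟩ := ProjCurve.exists_residueClassPoint_eq hw hwi hlt
    subst hyn
    refine (rpow_one_div_le_of_le_pow h0 (norm_nonneg (z.1 j₀ - w j₀)) hn.ne' ?_).trans
      (ProjCurve.norm_sub_le_chordalDist hw hwi z j₀)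
    refine (h1.trans (min_le_left _ _)).trans (h z (fun hzw => hyx ?_) hn)
    exact (ProjCurve.residueClassPoint_eq_iff hx).2 fun j => by simp [complexVec, hwi, hzw]
  · refine (rpow_one_div_le_of_le_pow h0 zero_le_one hn.ne' ?_).trans (not_lt.1 hlt)
    rw [one_pow]
    exact h1.trans (min_le_right _ _)
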